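/- Let $\mathbf w_*\in\mathbb R^d$ and $y_i=\mathbf w_*^\top\mathbf x_i+\varepsilon_i$, $i=1,\dots,n$ (with $d,n\ge 1$), where the pairs $(\mathbf x_i,\varepsilon_i)\in\mathbb R^d\times\mathbb R$ are i.i.d. and $\varepsilon_i$ is independent of $\mathbf x_i$. For $\alpha>0$ put $\phi_\alpha(x)=\alpha\log(1+x/\alpha)$ and $F_\alpha(\mathbf w)=\frac1{2n}\sum_{i=1}^n\phi_\alpha\bigl((\mathbf w^\top\mathbf x_i-y_i)^2\bigr)$. Assume that $\mathbf x_i$ is (centered) sub-Gaussian with parameter $\sigma_x^2>0$, i.e. $\mathrm E\exp(\mathbf u^\top\mathbf x_i)\le\exp(\sigma_x^2\|\mathbf u\|_2^2/2)$ for all $\mathbf u\in\mathbb R^d$, and that its covariance matrix $\Sigma_x$ has smallest eigenvalue $\lambda_{\min}(\Sigma_x)>0$. There are absolute constants $c,c'>0$, and constants $C_0,C>0$ depending only on $\sigma_x$ and $\lambda_{\min}(\Sigma_x)$, such that the following holds. Let $n\ge C_0\,d\log d$, let $\alpha,r>0$ and $\epsilon\in\mathbb R$, and let $0<T\le\sqrt\alpha/2$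 be such that $$c\,\sigma_x^2\Bigl(\Pr(\varepsilon_i^2\ge T^2/4)^{1/2}+\exp\bigl(-c'T^2/(2\sigma_x^2r^2)\bigr)\Bigr)\le\frac{\lambda_{\min}(\Sigma_x)}{20}.$$ Then with probability at least $1-c\exp(-c'\log d)$, every $\mathbf w_\alpha\in\mathbb R^d$ (possibly depending on the sample) with $\|\mathbf w_\alpha-\mathbf w_*\|_2\le r$ and $\|\nabla F_\alpha(\mathbf w_\alpha)\|_2\le\epsilon$ satisfies $$\|\mathbf w_\alpha-\mathbf w_*\|_2\le C\left(\sqrt{\frac{\alpha d\log d}{n}}+\frac{d\log d}{n}\,\frac{T^2}{r}+\epsilon\right).$$ -/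

import Mathlib

open MeasureTheory ProbabilityTheory
open scoped NNReal InnerProductSpace

namespace TruncatedLoss

noncomputable section

/-- The logarithmic truncation function `φ_α(x) = α log (1 + x / α)`, used for `x ≥ 0`, `α > 0`. -/
def phi (α x : ℝ) : ℝ := α * Real.log (1 + x / α)

/-- The truncated empirical square loss
`F_α(w) = (1 / 2n) ∑ i, φ_α ((⟪w, x_i⟫ - y_i) ^ 2)`. -/
def truncatedLoss {d n : ℕ} (α : ℝ) (x : Fin n → EuclideanSpace ℝ (Fin d)) (y : Fin n → ℝ)
    (w : EuclideanSpace ℝ (Fin d)) : ℝ :=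
  1 / (2 * (n : ℝ)) * ∑ i, phi α ((⟪w, x i⟫_ℝ - y i) ^ 2)

/-- A random vector `X` is (centered) sub-Gaussian with parameter `σ ^ 2`: every linear form
satisfies `E exp (t ⟪u, X⟫) ≤ exp (σ ^ 2 ‖u‖ ^ 2 t ^ 2 / 2)` for all real `t`. -/
def IsSubGaussianVector {Ω : Type*} [MeasurableSpace Ω] {d : ℕ}
    (X : Ω → EuclideanSpace ℝ (Fin d)) (σ : ℝ≥0) (μ : Measure Ω) : Prop :=
  ∀ u : EuclideanSpace ℝ (Fin d),
    HasSubgaussianMGF (fun ω => ⟪u, X ω⟫_ℝ) (σ ^ 2 * ‖u‖₊ ^ 2) μ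

/-- The covariance matrix of a random vector. -/
def covarianceMatrix {Ω : Type*} [MeasurableSpace Ω] {d : ℕ}
    (X : Ω → EuclideanSpace ℝ (Fin d)) (μ : Measure Ω) : Matrix (Fin d) (Fin d) ℝ :=
  Matrix.of fun j k => covariance (fun ω => X ω j) (fun ω => X ω k) μ

/-- The smallest (real) eigenvalue of a square matrix; meaningful for a symmetric matrix of
positive size, whose real spectrum is its finite nonempty set of eigenvalues. -/
def minEigenvalue {d : ℕ} (A : Matrix (Fin d) (Fin d) ℝ) : ℝ := sInf (spectrum ℝ A)

/-- The inputs `x i` and noises `ε i` are an i.i.d. sample `(x i, ε i)`, and each noise is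
independent of the corresponding input. -/
structure IsRegressionSample {Ω : Type*} [MeasurableSpace Ω] {d n : ℕ}
    (x : Fin n → Ω → EuclideanSpace ℝ (Fin d)) (ε : Fin n → Ω → ℝ) (μ : Measure Ω) : Prop where
  measurable_input : ∀ i, Measurable (x i)
  measurable_noise : ∀ i, Measurable (ε i)
  indep_sample : iIndepFun (fun i ω => (x i ω, ε i ω)) μ
  identDistrib : ∀ i j, IdentDistrib (fun ω => (x i ω, ε i ω)) (fun ω => (x j ω, ε j ω)) μ μ
  indep_noise : ∀ i, IndepFun (x i) (ε i) μ

end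

end TruncatedLoss

/-! Let v = w − w_*, let ρ = ‖v‖ and u = v/ρ, and let ψ(z) = z/(1 + z²/α), so that ⟨∇F_α(w), v⟩ is
the average of ψ(⟨v,x_i⟩ − ε_i)⟨v,x_i⟩. The secant slopes of ψ are at least −1/2 everywhere and at
least 2/5 on [−√α/2, √α/2]. Comparing with ψ(−ε_i), each summand gains (2/5)⟨v,x_i⟩², up to a loss
of at most ⟨v,x_i⟩² for large noise and the same for large input (`influence_increment_ge`).

Three facts, uniform in w, then suffice (`norm_sub_le_of_gradient_le`). The empirical second moment
in every direction u is at least (3/10)λ. The average loss is at most λ/100. The gradient at w_* has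
coordinates of order σ√(α log d / n). Hence (λ/10)ρ² ≤ ρ(tol + √d · 2σ√(α log d / n)).

The first two facts come from Chernoff bounds at the points of a net, since ⟨p,x⟩² has an
exponential moment. The indicator of a large input is not convex in u, so `excess`, a convex
majorant, replaces it; `convexOn_le_of_net` then carries the bound from the net to the ball. The net
has exp(O(d log d)) points, whence the sample size. The third fact holds because ψ is bounded by √α:
ψ(−ε_i)x_{ij} is sub-Gaussian however heavy the tail of the noise. -/

namespace TruncatedLoss

/-! ### Exponential moments of squares of sub-Gaussian variables -/

/-- Square-exponential moment of a sub-Gaussian variable, by integrating the moment generating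
function against a Gaussian weight. -/
lemma lintegral_exp_sq_le {Ω : Type*} [MeasurableSpace Ω] {μ : Measure Ω} [IsProbabilityMeasure μ]
    {X : Ω → ℝ} {c : ℝ≥0} (hX : Measurable X) (h : HasSubgaussianMGF X c μ) {s : ℝ}
    (hs : 0 < s) (hcs : (c : ℝ) ≤ s) :
    ∫⁻ ω, ENNReal.ofReal (Real.exp (X ω ^ 2 / (4 * s))) ∂μ ≤ ENNReal.ofReal 2 := by
  have hK : 0 < √(Real.pi / s) := Real.sqrt_pos.2 (by positivity)
  -- Completing the square in g. After swapping integrals, the moment generating function costs at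
  -- most exp(s g²/2), which leaves half of the Gaussian weight; the ratio of normalisations is √2 ≤
  -- 2.
  have key : ∀ ω, ENNReal.ofReal (√(Real.pi / s)) * ENNReal.ofReal (Real.exp (X ω ^ 2 / (4 * s)))
      = ∫⁻ g : ℝ, ENNReal.ofReal (Real.exp (g * X ω - s * g ^ 2)) := by
    intro ω
    have e1 : ∀ g : ℝ, Real.exp (g * X ω - s * g ^ 2)
        = Real.exp (X ω ^ 2 / (4 * s)) * Real.exp (-s * (g - X ω / (2 * s)) ^ 2) := by
      intro g
      rw [← Real.exp_add]
      congr 1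
      field_simp
      ring
    have hint : Integrable (fun g : ℝ => Real.exp (-s * (g - X ω / (2 * s)) ^ 2)) :=
      (integrable_exp_neg_mul_sq hs).comp_sub_right _
    rw [← ofReal_integral_eq_lintegral_ofReal]
    · simp_rw [e1]
      rw [integral_const_mul, integral_sub_right_eq_self (fun g : ℝ => Real.exp (-s * g ^ 2)),
        integral_gaussian, ← ENNReal.ofReal_mul hK.le, mul_comm]
    · simp_rw [e1]
      exact hint.const_mul _
    · exact Filter.Eventually.of_forall fun g => (Real.exp_pos _).le
  have hmain : ENNReal.ofReal (√(Real.pi / s)) *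
      ∫⁻ ω, ENNReal.ofReal (Real.exp (X ω ^ 2 / (4 * s))) ∂μ
      ≤ ENNReal.ofReal (√(Real.pi / s)) * ENNReal.ofReal 2 := by
    rw [← lintegral_const_mul _ (by fun_prop)]
    simp_rw [key]
    rw [lintegral_lintegral_swap (by fun_prop)]
    calc ∫⁻ g : ℝ, ∫⁻ ω, ENNReal.ofReal (Real.exp (g * X ω - s * g ^ 2)) ∂μ
        ≤ ∫⁻ g : ℝ, ENNReal.ofReal (Real.exp (-(s / 2) * g ^ 2)) := by
          refine lintegral_mono fun g => ?_
          have hi : Integrable (fun ω => Real.exp (g * X ω - s * g ^ 2)) μ := by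
            simp_rw [Real.exp_sub]
            exact (h.integrable_exp_mul g).div_const _
          rw [← ofReal_integral_eq_lintegral_ofReal hi
            (Filter.Eventually.of_forall fun ω => (Real.exp_pos _).le)]
          refine ENNReal.ofReal_le_ofReal ?_
          simp_rw [Real.exp_sub]
          rw [integral_div, div_le_iff₀ (Real.exp_pos _), ← Real.exp_add]
          refine (h.mgf_le g).trans (Real.exp_le_exp.2 ?_)
          nlinarith [sq_nonneg g]
      _ = ENNReal.ofReal (√(Real.pi / (s / 2))) := by
          rw [← ofReal_integral_eq_lintegral_ofReal (integrable_exp_neg_mul_sq (by positivity))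
            (Filter.Eventually.of_forall fun g => (Real.exp_pos _).le), integral_gaussian]
      _ ≤ ENNReal.ofReal (√(Real.pi / s)) * ENNReal.ofReal 2 := by
          rw [← ENNReal.ofReal_mul hK.le]
          refine ENNReal.ofReal_le_ofReal ?_
          rw [show Real.pi / (s / 2) = (Real.pi / s) * 2 by field_simp,
            Real.sqrt_mul (by positivity)]
          refine mul_le_mul_of_nonneg_left ?_ hK.le
          rw [Real.sqrt_le_left (by norm_num)]
          norm_num
  exact (ENNReal.mul_le_mul_iff_right (by simpa using hK) ENNReal.ofReal_ne_top).1 hmain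

lemma integrable_exp_sq {Ω : Type*} [MeasurableSpace Ω] {μ : Measure Ω} [IsProbabilityMeasure μ]
    {X : Ω → ℝ} {c : ℝ≥0} (hX : Measurable X) (h : HasSubgaussianMGF X c μ) {s : ℝ}
    (hs : 0 < s) (hcs : (c : ℝ) ≤ s) :
    Integrable (fun ω => Real.exp (X ω ^ 2 / (4 * s))) μ := by
  refine ⟨by fun_prop, ?_⟩
  rw [hasFiniteIntegral_iff_ofReal (Filter.Eventually.of_forall fun ω => (Real.exp_pos _).le)]
  exact (lintegral_exp_sq_le hX h hs hcs).trans_lt ENNReal.ofReal_lt_top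

lemma integral_exp_sq_le {Ω : Type*} [MeasurableSpace Ω] {μ : Measure Ω} [IsProbabilityMeasure μ]
    {X : Ω → ℝ} {c : ℝ≥0} (hX : Measurable X) (h : HasSubgaussianMGF X c μ) {s : ℝ}
    (hs : 0 < s) (hcs : (c : ℝ) ≤ s) :
    ∫ ω, Real.exp (X ω ^ 2 / (4 * s)) ∂μ ≤ 2 := by
  rw [← ENNReal.ofReal_le_ofReal_iff (by norm_num), ofReal_integral_eq_lintegral_ofReal
    (integrable_exp_sq hX h hs hcs) (Filter.Eventually.of_forall fun ω => (Real.exp_pos _).le)]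
  exact lintegral_exp_sq_le hX h hs hcs

/-! ### Chernoff bounds for sums of nonnegative variables -/

lemma exp_le_one_add_add_sq_mul_exp_abs (a : ℝ) :
    Real.exp a ≤ 1 + a + a ^ 2 * Real.exp |a| := by
  rcases le_or_gt |a| 1 with h | h
  · have h1 := (abs_le.1 (Real.abs_exp_sub_one_sub_id_le h)).2
    have h2 : a ^ 2 * 1 ≤ a ^ 2 * Real.exp |a| :=
      mul_le_mul_of_nonneg_left (Real.one_le_exp (abs_nonneg a)) (sq_nonneg a)
    linarith
  · have h1 : 1 ≤ a ^ 2 := by rw [← sq_abs]; nlinarith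
    rcases le_total 0 a with ha | ha
    · rw [abs_of_nonneg ha]
      nlinarith [Real.exp_pos a]
    · rw [abs_of_nonpos ha] at h ⊢
      have h2 : Real.exp a ≤ 1 := Real.exp_le_one_iff.2 ha
      have h3 := Real.add_one_le_exp (-a)
      nlinarith [Real.exp_pos (-a)]

lemma integrable_of_integrable_exp {Ω : Type*} [MeasurableSpace Ω] {μ : Measure Ω}
    {Z : Ω → ℝ} {η : ℝ} (hη : 0 < η) (hZ : Measurable Z) (h0 : ∀ ω, 0 ≤ Z ω)
    (hint : Integrable (fun ω => Real.exp (η * Z ω)) μ) : Integrable Z μ := by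
  refine (hint.const_mul (1 / η)).mono' hZ.aestronglyMeasurable
    (Filter.Eventually.of_forall fun ω => ?_)
  rw [Real.norm_of_nonneg (h0 ω), one_div, inv_mul_eq_div, le_div_iff₀ hη]
  linarith [Real.add_one_le_exp (η * Z ω)]

lemma integrable_exp_mul_of_abs_le {Ω : Type*} [MeasurableSpace Ω] {μ : Measure Ω}
    {Z : Ω → ℝ} {η s : ℝ} (hZ : Measurable Z) (h0 : ∀ ω, 0 ≤ Z ω)
    (hint : Integrable (fun ω => Real.exp (η * Z ω)) μ) (hs : |s| ≤ η / 2) :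
    Integrable (fun ω => Real.exp (s * Z ω)) μ := by
  refine hint.mono' (by fun_prop) (Filter.Eventually.of_forall fun ω => ?_)
  rw [Real.norm_of_nonneg (Real.exp_pos _).le]
  refine Real.exp_le_exp.2 (mul_le_mul_of_nonneg_right ?_ (h0 ω))
  linarith [le_abs_self s, abs_nonneg s]

/-- The moment generating function near `0` of a nonnegative variable with an exponential
moment. -/
lemma mgf_le_exp_quadratic {Ω : Type*} [MeasurableSpace Ω] {μ : Measure Ω} [IsProbabilityMeasure μ]
    {Z : Ω → ℝ} {η s : ℝ} (hη : 0 < η) (hZ : Measurable Z) (h0 : ∀ ω, 0 ≤ Z ω)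
    (hint : Integrable (fun ω => Real.exp (η * Z ω)) μ)
    (hle : ∫ ω, Real.exp (η * Z ω) ∂μ ≤ 2) (hs : |s| ≤ η / 2) :
    mgf Z μ s ≤ Real.exp (s * ∫ ω, Z ω ∂μ + s ^ 2 * (16 / η ^ 2)) := by
  have hZi := integrable_of_integrable_exp hη hZ h0 hint
  -- The budget exp(ηZ) splits into two halves: one absorbs Z², the other exp|sZ|.
  have hpt : ∀ ω, Real.exp (s * Z ω)
      ≤ 1 + s * Z ω + s ^ 2 * (8 / η ^ 2) * Real.exp (η * Z ω) := by
    intro ω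
    refine (exp_le_one_add_add_sq_mul_exp_abs _).trans ?_
    have h1 : |s * Z ω| ≤ η / 2 * Z ω := by
      rw [abs_mul, abs_of_nonneg (h0 ω)]
      exact mul_le_mul_of_nonneg_right hs (h0 ω)
    have h2 : (η / 2 * Z ω) ^ 2 / 2 ≤ Real.exp (η / 2 * Z ω) := by
      have := Real.quadratic_le_exp_of_nonneg (x := η / 2 * Z ω)
        (mul_nonneg (by positivity) (h0 ω))
      nlinarith [mul_nonneg (half_pos hη).le (h0 ω)]
    have h3 : Real.exp (η * Z ω) = Real.exp (η / 2 * Z ω) * Real.exp (η / 2 * Z ω) := by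
      rw [← Real.exp_add]; ring_nf
    have h4 : Z ω ^ 2 ≤ 8 / η ^ 2 * Real.exp (η / 2 * Z ω) := by
      rw [div_mul_eq_mul_div, le_div_iff₀ (by positivity)]
      nlinarith
    have h5 : Z ω ^ 2 * Real.exp |s * Z ω| ≤ 8 / η ^ 2 * Real.exp (η * Z ω) := by
      rw [h3, ← mul_assoc]
      exact mul_le_mul h4 (Real.exp_le_exp.2 h1) (Real.exp_pos _).le (by positivity)
    have h6 := mul_le_mul_of_nonneg_left h5 (sq_nonneg s)
    rw [mul_pow]
    linarith
  have hlin : Integrable (fun ω => 1 + s * Z ω) μ := (integrable_const _).add (hZi.const_mul s)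
  have hmono : mgf Z μ s ≤ ∫ ω, (1 + s * Z ω + s ^ 2 * (8 / η ^ 2) * Real.exp (η * Z ω)) ∂μ :=
    integral_mono (integrable_exp_mul_of_abs_le hZ h0 hint hs)
      (hlin.add (hint.const_mul _)) hpt
  rw [integral_add hlin (hint.const_mul _),
    integral_add (integrable_const _) (hZi.const_mul s), integral_const_mul, integral_const_mul]
    at hmono
  simp only [integral_const, probReal_univ, smul_eq_mul, mul_one] at hmono
  have h7 : s ^ 2 * (8 / η ^ 2) * ∫ ω, Real.exp (η * Z ω) ∂μ ≤ s ^ 2 * (8 / η ^ 2) * 2 :=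
    mul_le_mul_of_nonneg_left hle (by positivity)
  have h8 := Real.add_one_le_exp (s * ∫ ω, Z ω ∂μ + s ^ 2 * (16 / η ^ 2))
  have h9 : s ^ 2 * (8 / η ^ 2) * 2 = s ^ 2 * (16 / η ^ 2) := by ring
  linarith

/-- The exponential rate in the deviation bounds for averages of nonnegative variables. -/
noncomputable def chernoffRate (η t : ℝ) : ℝ :=
  min (η / 2) (t * η ^ 2 / 32) * t / 2

lemma chernoffRate_pos {η t : ℝ} (hη : 0 < η) (ht : 0 < t) : 0 < chernoffRate η t := by
  unfold chernoffRate
  have : 0 < min (η / 2) (t * η ^ 2 / 32) := lt_min (by positivity) (by positivity)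
  positivity

/-- The quadratic term of the log moment generating function uses up at most half of the gain st;
the other half is the deviation rate. -/
lemma sq_mul_le_chernoffRate {η t s : ℝ} (hη : 0 < η)
    (hs : 0 ≤ s) (hst : s ≤ t * η ^ 2 / 32) : s ^ 2 * (16 / η ^ 2) ≤ s * t / 2 := by
  rw [mul_div_assoc', div_le_iff₀ (by positivity)]
  nlinarith

lemma mgf_sum_le {Ω : Type*} [MeasurableSpace Ω] {μ : Measure Ω} [IsProbabilityMeasure μ] {n : ℕ}
    {Z : Fin n → Ω → ℝ} {η s a : ℝ} (hη : 0 < η) (hZ : ∀ i, Measurable (Z i))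
    (h0 : ∀ i ω, 0 ≤ Z i ω) (hind : iIndepFun Z μ)
    (hint : ∀ i, Integrable (fun ω => Real.exp (η * Z i ω)) μ)
    (hle : ∀ i, ∫ ω, Real.exp (η * Z i ω) ∂μ ≤ 2) (hs : |s| ≤ η / 2)
    (ha : ∀ i, s * ∫ ω, Z i ω ∂μ ≤ a) :
    mgf (∑ i, Z i) μ s ≤ Real.exp (n * (a + s ^ 2 * (16 / η ^ 2))) := by
  rw [hind.mgf_sum hZ]
  calc ∏ i, mgf (Z i) μ s ≤ ∏ _i : Fin n, Real.exp (a + s ^ 2 * (16 / η ^ 2)) := by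
        refine Finset.prod_le_prod (fun i _ => mgf_nonneg) fun i _ => ?_
        refine (mgf_le_exp_quadratic hη (hZ i) (h0 i) (hint i) (hle i) hs).trans ?_
        exact Real.exp_le_exp.2 (by linarith [ha i])
    _ = _ := by
        rw [Finset.prod_const, Finset.card_univ, Fintype.card_fin, ← Real.exp_nat_mul]

lemma integrable_exp_mul_sum {Ω : Type*} [MeasurableSpace Ω] {μ : Measure Ω}
    [IsProbabilityMeasure μ] {n : ℕ}
    {Z : Fin n → Ω → ℝ} {η s : ℝ} (hZ : ∀ i, Measurable (Z i))
    (h0 : ∀ i ω, 0 ≤ Z i ω) (hind : iIndepFun Z μ)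
    (hint : ∀ i, Integrable (fun ω => Real.exp (η * Z i ω)) μ) (hs : |s| ≤ η / 2) :
    Integrable (fun ω => Real.exp (s * (∑ i, Z i) ω)) μ :=
  hind.integrable_exp_mul_sum hZ fun i _ =>
    integrable_exp_mul_of_abs_le (hZ i) (h0 i) (hint i) hs

lemma measureReal_sum_ge_le {Ω : Type*} [MeasurableSpace Ω] {μ : Measure Ω}
    [IsProbabilityMeasure μ] {n : ℕ}
    {Z : Fin n → Ω → ℝ} {η m t : ℝ} (hη : 0 < η) (ht : 0 < t) (hZ : ∀ i, Measurable (Z i))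
    (h0 : ∀ i ω, 0 ≤ Z i ω) (hind : iIndepFun Z μ)
    (hint : ∀ i, Integrable (fun ω => Real.exp (η * Z i ω)) μ)
    (hle : ∀ i, ∫ ω, Real.exp (η * Z i ω) ∂μ ≤ 2) (hm : ∀ i, ∫ ω, Z i ω ∂μ ≤ m) :
    μ.real {ω | n * (m + t) ≤ ∑ i, Z i ω} ≤ Real.exp (-(n * chernoffRate η t)) := by
  have hpos : 0 < min (η / 2) (t * η ^ 2 / 32) := lt_min (by positivity) (by positivity)
  unfold chernoffRate
  set s := min (η / 2) (t * η ^ 2 / 32) with hsdef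
  have hs : |s| ≤ η / 2 := by rw [abs_of_pos hpos]; exact min_le_left _ _
  have h1 := measure_ge_le_exp_mul_mgf (μ := μ) (X := ∑ i, Z i) (t := s) (n * (m + t)) hpos.le
    (integrable_exp_mul_sum hZ h0 hind hint hs)
  have h2 := mgf_sum_le (a := s * m) hη hZ h0 hind hint hle hs
    fun i => mul_le_mul_of_nonneg_left (hm i) hpos.le
  have h3 := sq_mul_le_chernoffRate hη hpos.le (min_le_right (η / 2) (t * η ^ 2 / 32))
  simp only [Finset.sum_apply] at h1
  refine h1.trans ((mul_le_mul_of_nonneg_left h2 (Real.exp_pos _).le).trans ?_)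
  rw [← Real.exp_add]
  refine Real.exp_le_exp.2 ?_
  have h4 := mul_le_mul_of_nonneg_left h3 (Nat.cast_nonneg (α := ℝ) n)
  linarith

lemma measureReal_sum_le_le {Ω : Type*} [MeasurableSpace Ω] {μ : Measure Ω}
    [IsProbabilityMeasure μ] {n : ℕ}
    {Z : Fin n → Ω → ℝ} {η m t : ℝ} (hη : 0 < η) (ht : 0 < t) (hZ : ∀ i, Measurable (Z i))
    (h0 : ∀ i ω, 0 ≤ Z i ω) (hind : iIndepFun Z μ)
    (hint : ∀ i, Integrable (fun ω => Real.exp (η * Z i ω)) μ)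
    (hle : ∀ i, ∫ ω, Real.exp (η * Z i ω) ∂μ ≤ 2) (hm : ∀ i, m ≤ ∫ ω, Z i ω ∂μ) :
    μ.real {ω | ∑ i, Z i ω ≤ n * (m - t)} ≤ Real.exp (-(n * chernoffRate η t)) := by
  have hpos : 0 < min (η / 2) (t * η ^ 2 / 32) := lt_min (by positivity) (by positivity)
  unfold chernoffRate
  set s := min (η / 2) (t * η ^ 2 / 32) with hsdef
  have hs : |-s| ≤ η / 2 := by rw [abs_neg, abs_of_pos hpos]; exact min_le_left _ _
  have h1 := measure_le_le_exp_mul_mgf (μ := μ) (X := ∑ i, Z i) (t := -s) (n * (m - t))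
    (by linarith) (integrable_exp_mul_sum hZ h0 hind hint hs)
  have h2 := mgf_sum_le (a := -s * m) hη hZ h0 hind hint hle hs
    fun i => mul_le_mul_of_nonpos_left (hm i) (by linarith)
  have h3 := sq_mul_le_chernoffRate hη hpos.le (min_le_right (η / 2) (t * η ^ 2 / 32))
  simp only [Finset.sum_apply] at h1
  refine h1.trans ((mul_le_mul_of_nonneg_left h2 (Real.exp_pos _).le).trans ?_)
  rw [← Real.exp_add]
  refine Real.exp_le_exp.2 ?_
  have h4 := mul_le_mul_of_nonneg_left h3 (Nat.cast_nonneg (α := ℝ) n)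
  rw [neg_sq]
  linarith

/-! ### Nets of the unit ball -/

/-- Rounding is towards zero, so that rounding a vector of the unit ball coordinatewise stays in the
ball. -/
lemma exists_int_abs_sub_mul_le (h : ℝ) (hh : 0 < h) (a : ℝ) :
    ∃ k : ℤ, |a - h * k| ≤ h ∧ |h * k| ≤ |a| := by
  rcases le_total 0 a with ha | ha
  · refine ⟨⌊a / h⌋, ?_⟩
    have h1 := Int.floor_le (a / h)
    have h2 := (Int.lt_floor_add_one (a / h)).le
    have h3 : (0 : ℝ) ≤ ⌊a / h⌋ := by exact_mod_cast Int.floor_nonneg.2 (by positivity)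
    rw [le_div_iff₀ hh] at h1
    rw [div_le_iff₀ hh] at h2
    rw [abs_of_nonneg ha, abs_of_nonneg (mul_nonneg hh.le h3), abs_le]
    exact ⟨⟨by linarith, by linarith⟩, by linarith⟩
  · refine ⟨⌈a / h⌉, ?_⟩
    have h1 := Int.le_ceil (a / h)
    have h2 := (Int.ceil_lt_add_one (a / h)).le
    have h3 : (⌈a / h⌉ : ℝ) ≤ 0 := by
      exact_mod_cast Int.ceil_le.2 (by simpa using div_nonpos_of_nonpos_of_nonneg ha hh.le)
    rw [div_le_iff₀ hh] at h1
    rw [← sub_le_iff_le_add, le_div_iff₀ hh] at h2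
    rw [abs_of_nonpos ha, abs_of_nonpos (mul_nonpos_of_nonneg_of_nonpos hh.le h3), abs_le]
    exact ⟨⟨by linarith, by linarith⟩, by linarith⟩

/-- A finite net of the Euclidean unit ball, made of grid points. -/
lemma exists_finset_net {d : ℕ} (hd : 0 < d) {δ : ℝ} (hδ : 0 < δ) (hδ1 : δ ≤ 1) :
    ∃ N : Finset (EuclideanSpace ℝ (Fin d)), (∀ p ∈ N, ‖p‖ ≤ 1) ∧
      (∀ u : EuclideanSpace ℝ (Fin d), ‖u‖ ≤ 1 → ∃ p ∈ N, ‖u - p‖ ≤ δ) ∧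
      (N.card : ℝ) ≤ (3 * √d / δ) ^ d := by
  classical
  have hd1 : (1 : ℝ) ≤ √d := by
    rw [Real.one_le_sqrt]; exact_mod_cast hd
  -- With this mesh, d coordinate errors of size h add up to δ in Euclidean norm.
  set h : ℝ := δ / √d with hh
  have hpos : 0 < h := by positivity
  have hle : h ≤ 1 := by rw [hh, div_le_one (by positivity)]; linarith
  set m : ℤ := ⌊1 / h⌋ with hm
  let f : (Fin d → ℤ) → EuclideanSpace ℝ (Fin d) := fun k => WithLp.toLp 2 fun j => h * k j
  refine ⟨((Fintype.piFinset fun _ : Fin d => Finset.Icc (-m) m).image f).filter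
    (fun p => ‖p‖ ≤ 1), fun p hp => (Finset.mem_filter.1 hp).2, fun u hu => ?_, ?_⟩
  · choose k hk1 hk2 using fun j => exists_int_abs_sub_mul_le h hpos (u j)
    refine ⟨f k, Finset.mem_filter.2 ⟨Finset.mem_image_of_mem _ ?_, ?_⟩, ?_⟩
    · rw [Fintype.mem_piFinset]
      intro j
      have h1 : |(u j : ℝ)| ≤ 1 := (PiLp.norm_apply_le u j).trans hu
      have h2 := (hk2 j).trans h1
      rw [abs_mul, abs_of_pos hpos, mul_comm, ← le_div_iff₀ hpos] at h2
      have h3 : |k j| ≤ m := Int.le_floor.2 (by rw [Int.cast_abs]; exact h2)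
      exact Finset.mem_Icc.2 (abs_le.1 h3)
    · refine le_trans ?_ hu
      rw [EuclideanSpace.norm_eq, EuclideanSpace.norm_eq]
      refine Real.sqrt_le_sqrt (Finset.sum_le_sum fun j _ => ?_)
      exact pow_le_pow_left₀ (norm_nonneg _) (hk2 j) 2
    · rw [EuclideanSpace.norm_eq]
      refine Real.sqrt_le_iff.2 ⟨hδ.le, ?_⟩
      calc ∑ j, ‖(u - f k) j‖ ^ 2 ≤ ∑ _j : Fin d, h ^ 2 :=
            Finset.sum_le_sum fun j _ => pow_le_pow_left₀ (norm_nonneg _) (hk1 j) 2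
        _ = δ ^ 2 := by
            rw [Finset.sum_const, Finset.card_univ, Fintype.card_fin, nsmul_eq_mul, hh, div_pow,
              Real.sq_sqrt (Nat.cast_nonneg d)]
            field_simp
  · have hm0 : 0 ≤ m := Int.floor_nonneg.2 (by positivity)
    have hcard : (((Fintype.piFinset fun _ : Fin d => Finset.Icc (-m) m).image f).filter
        (fun p => ‖p‖ ≤ 1)).card ≤ ((2 * m + 1).toNat) ^ d := by
      refine (Finset.card_filter_le _ _).trans (Finset.card_image_le.trans ?_)
      rw [Fintype.card_piFinset]
      simp only [Int.card_Icc, Finset.prod_const, Finset.card_univ, Fintype.card_fin]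
      exact Nat.pow_le_pow_left (by omega) d
    have h1 : (((2 * m + 1).toNat : ℕ) : ℝ) ≤ 3 * √d / δ := by
      have h2 : (((2 * m + 1).toNat : ℕ) : ℝ) = 2 * m + 1 := by
        have : (((2 * m + 1).toNat : ℕ) : ℤ) = 2 * m + 1 := Int.toNat_of_nonneg (by omega)
        exact_mod_cast congrArg (Int.cast : ℤ → ℝ) this
      have h3 : (m : ℝ) ≤ 1 / h := Int.floor_le _
      have h4 : 1 ≤ 1 / h := (one_le_div hpos).2 hle
      have h5 : 3 * √d / δ = 3 * (1 / h) := by rw [hh]; field_simp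
      rw [h2, h5]
      linarith
    calc _ ≤ ((((2 * m + 1).toNat) ^ d : ℕ) : ℝ) := by exact_mod_cast hcard
      _ ≤ _ := by
        push_cast
        exact pow_le_pow_left₀ (Nat.cast_nonneg _) h1 d

/-- A convex continuous function on the unit ball is bounded by its values at the doubled points
of a `1 / 2`-net. -/
lemma convexOn_le_of_net {d : ℕ} {G : EuclideanSpace ℝ (Fin d) → ℝ}
    (hG : ConvexOn ℝ Set.univ G) (hc : Continuous G) {N : Finset (EuclideanSpace ℝ (Fin d))}
    (hN : ∀ u : EuclideanSpace ℝ (Fin d), ‖u‖ ≤ 1 → ∃ p ∈ N, ‖u - p‖ ≤ 1 / 2) {M : ℝ}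
    (hM : ∀ p ∈ N, G ((2 : ℝ) • p) ≤ M) {u : EuclideanSpace ℝ (Fin d)} (hu : ‖u‖ ≤ 1) :
    G u ≤ M := by
  obtain ⟨w, hw, hmax⟩ := (isCompact_closedBall (0 : EuclideanSpace ℝ (Fin d)) 1).exists_isMaxOn
    ⟨0, by simp⟩ hc.continuousOn
  have hw1 : ‖w‖ ≤ 1 := by simpa using hw
  obtain ⟨p, hp, hwp⟩ := hN w hw1
  -- The maximiser w is the midpoint of 2p and 2(w − p), and the latter is again in the ball; so G w
  -- ≤ (M + G w)/2.
  have h1 := hG.2 (Set.mem_univ ((2 : ℝ) • p)) (Set.mem_univ ((2 : ℝ) • (w - p)))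
    (by norm_num : (0 : ℝ) ≤ 1 / 2) (by norm_num : (0 : ℝ) ≤ 1 / 2) (by norm_num)
  have h2 : (1 / 2 : ℝ) • (2 : ℝ) • p + (1 / 2 : ℝ) • (2 : ℝ) • (w - p) = w := by
    rw [smul_smul, smul_smul]; norm_num
  have h3 : G ((2 : ℝ) • (w - p)) ≤ G w := by
    refine hmax ?_
    rw [mem_closedBall_zero_iff, norm_smul]
    norm_num
    linarith
  rw [h2, smul_eq_mul, smul_eq_mul] at h1
  have h4 : G u ≤ G w := hmax (by simpa using hu)
  linarith [hM p hp]

/-! ### The influence function and its monotonicity -/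

/-- The influence function `z / (1 + z ^ 2 / α)`, half the derivative of `φ_α (z ^ 2)`. -/
noncomputable def influence (α z : ℝ) : ℝ := z / (1 + z ^ 2 / α)

@[fun_prop]
lemma measurable_influence (α : ℝ) : Measurable (influence α) := by
  unfold influence; fun_prop

/-- This bound is the source of the factor √α in the final rate. The sharp constant would be √α/2.
-/
lemma abs_influence_le {α : ℝ} (hα : 0 < α) (z : ℝ) : |influence α z| ≤ √α := by
  have h1 : 0 < 1 + z ^ 2 / α := by positivity
  rw [influence, abs_div, abs_of_pos h1, div_le_iff₀ h1]
  have h2 : √α * (1 + z ^ 2 / α) = √α + z ^ 2 / √α := by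
    have : α = √α * √α := (Real.mul_self_sqrt hα.le).symm
    have h0 : √α ≠ 0 := (Real.sqrt_pos.2 hα).ne'
    rw [mul_add, mul_one]
    congr 1
    nth_rewrite 2 [this]
    field_simp
  have h3 : 0 < √α := Real.sqrt_pos.2 hα
  rw [h2, ← sub_nonneg]
  have h4 : √α + z ^ 2 / √α - |z| = ((√α - |z| / 2) ^ 2 + 3 / 4 * z ^ 2) / √α := by
    field_simp
    nlinarith [sq_abs z]
  rw [h4]
  positivity

lemma influence_sub_influence {α : ℝ} (hα : 0 < α) (a b : ℝ) :
    influence α a - influence α b =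
      (a - b) * ((1 - a * b / α) / ((1 + a ^ 2 / α) * (1 + b ^ 2 / α))) := by
  have h1 : α + a ^ 2 ≠ 0 := by positivity
  have h2 : α + b ^ 2 ≠ 0 := by positivity
  unfold influence
  field_simp
  ring

/-- Any lower bound no smaller than −3/5 would do: the slope then falls short of 2/5 by at most 1,
the weight of a discarded sample. -/
lemma slope_ge_neg {α : ℝ} (hα : 0 < α) (a b : ℝ) :
    -(1 / 2) ≤ (1 - a * b / α) / ((1 + a ^ 2 / α) * (1 + b ^ 2 / α)) := by
  rw [le_div_iff₀ (by positivity)]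
  have h : 0 ≤ (a - b) ^ 2 / α := by positivity
  have h' : (a - b) ^ 2 / α = a ^ 2 / α + b ^ 2 / α - 2 * (a * b / α) := by ring
  have h3 : 0 ≤ a ^ 2 / α * (b ^ 2 / α) := by positivity
  nlinarith

lemma slope_ge_of_abs_le {α T a b : ℝ} (hα : 0 < α) (hT : T ≤ √α / 2) (ha : |a| ≤ T)
    (hb : |b| ≤ T) :
    2 / 5 ≤ (1 - a * b / α) / ((1 + a ^ 2 / α) * (1 + b ^ 2 / α)) := by
  have hT0 : 0 ≤ T := (abs_nonneg a).trans ha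
  have hT2 : T ^ 2 ≤ α / 4 := by
    have := pow_le_pow_left₀ hT0 hT 2
    rw [div_pow, Real.sq_sqrt hα.le] at this
    linarith
  have h1 : a ^ 2 / α ≤ 1 / 4 := by
    rw [div_le_iff₀ hα, ← sq_abs]
    linarith [pow_le_pow_left₀ (abs_nonneg a) ha 2]
  have h2 : b ^ 2 / α ≤ 1 / 4 := by
    rw [div_le_iff₀ hα, ← sq_abs]
    linarith [pow_le_pow_left₀ (abs_nonneg b) hb 2]
  have h3 : a * b / α ≤ 1 / 4 := by
    have h : 0 ≤ (a - b) ^ 2 / α := by positivity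
    have h' : (a - b) ^ 2 / α = a ^ 2 / α + b ^ 2 / α - 2 * (a * b / α) := by ring
    linarith
  have h4 : 0 ≤ a ^ 2 / α := by positivity
  have h5 : 0 ≤ b ^ 2 / α := by positivity
  rw [le_div_iff₀ (by positivity)]
  nlinarith

/-- The positive part of `|z| - t`, squared and rescaled: a convex majorant of the truncated
square `z ^ 2` on `{|z| > 2 t}`. -/
noncomputable def excess (t z : ℝ) : ℝ := 4 * (max (|z| - t) 0) ^ 2

lemma excess_nonneg (t z : ℝ) : 0 ≤ excess t z := by unfold excess; positivity

/-- Here |z| − t is at least |z|/2, which explains the factor 4 in `excess`. -/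
lemma sq_le_excess {t z : ℝ} (hz : 2 * t ≤ |z|) : z ^ 2 ≤ excess t z := by
  have h := le_max_left (|z| - t) 0
  have h2 := le_max_right (|z| - t) 0
  unfold excess
  rw [← sq_abs]
  nlinarith [abs_nonneg z]

lemma excess_le {t : ℝ} (ht : 0 ≤ t) (z : ℝ) : excess t z ≤ 4 * z ^ 2 := by
  unfold excess
  rw [← sq_abs z]
  have h : max (|z| - t) 0 ≤ |z| := max_le (by linarith) (abs_nonneg z)
  linarith [pow_le_pow_left₀ (le_max_right (|z| - t) 0) h 2]

lemma excess_eq_zero {t z : ℝ} (hz : |z| ≤ t) : excess t z = 0 := by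
  unfold excess
  rw [max_eq_right (by linarith)]
  simp

lemma convexOn_excess (t : ℝ) : ConvexOn ℝ Set.univ (excess t) := by
  have h1 : ConvexOn ℝ Set.univ (fun z : ℝ => max (|z| - t) 0) :=
    ((convexOn_norm (E := ℝ) convex_univ).sub (concaveOn_const t convex_univ)).sup
      (convexOn_const 0 convex_univ)
  have h2 := h1.pow (fun z _ => le_max_right _ _) 2
  exact h2.smul (by norm_num : (0 : ℝ) ≤ 4)

@[fun_prop]
lemma continuous_excess (t : ℝ) : Continuous (excess t) := by
  unfold excess; fun_prop

/-- Strong monotonicity of the influence function, up to the contribution of large noises and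
large inputs. -/
lemma influence_increment_ge {α T s e : ℝ} (hα : 0 < α) (hT : T ≤ √α / 2) :
    2 / 5 * s ^ 2 - (if T ^ 2 / 4 ≤ e ^ 2 then s ^ 2 else 0)
        - (if T / 2 < |s| then s ^ 2 else 0)
      ≤ (influence α (s - e) - influence α (-e)) * s := by
  rw [influence_sub_influence hα]
  have h0 := slope_ge_neg hα (s - e) (-e)
  set q := (1 - (s - e) * -e / α) / ((1 + (s - e) ^ 2 / α) * (1 + (-e) ^ 2 / α)) with hq
  have hs := sq_nonneg s
  have h1 : (s - e - -e) * q * s = q * s ^ 2 := by ring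
  rw [h1]
  split_ifs with ha hb hb
  · nlinarith
  · nlinarith
  · nlinarith
  -- Neither noise nor input is large, so s − e and −e both lie in [−T, T], where the slope is at
  -- least 2/5. A negative T would contradict |s| ≤ T/2.
  · have he : |e| < T / 2 ∨ T < 0 := by
      by_contra! hcon
      refine ha ?_
      rw [← sq_abs e]
      nlinarith
    rcases he with he | he
    · have : 2 / 5 ≤ q := slope_ge_of_abs_le hα hT
        ((abs_sub _ _).trans (by linarith [not_lt.1 hb])) (by rw [abs_neg]; linarith [abs_nonneg e])
      nlinarith
    · exact absurd (lt_of_lt_of_le (by linarith) (abs_nonneg s)) hb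

/-! ### The gradient of the loss -/

lemma hasDerivAt_phi_sq {α : ℝ} (hα : 0 < α) (z : ℝ) :
    HasDerivAt (fun z => phi α (z ^ 2)) (2 * influence α z) z := by
  have h1 : HasDerivAt (fun z : ℝ => 1 + z ^ 2 / α) (2 * z / α) z := by
    have := ((hasDerivAt_pow 2 z).div_const α).const_add 1
    simpa using this
  have h2 := (h1.log (by positivity)).const_mul α
  refine h2.congr_deriv ?_
  have : α + z ^ 2 ≠ 0 := by positivity
  unfold influence
  field_simp

lemma inner_gradient_truncatedLoss {d n : ℕ} {α : ℝ} (hα : 0 < α)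
    (x : Fin n → EuclideanSpace ℝ (Fin d)) (y : Fin n → ℝ) (w v : EuclideanSpace ℝ (Fin d)) :
    ⟪gradient (truncatedLoss α x y) w, v⟫_ℝ
      = 1 / (n : ℝ) * ∑ i, influence α (⟪w, x i⟫_ℝ - y i) * ⟪v, x i⟫_ℝ := by
  have h1 : ∀ i, HasFDerivAt (fun w => phi α ((⟪w, x i⟫_ℝ - y i) ^ 2))
      ((2 * influence α (⟪w, x i⟫_ℝ - y i)) • innerSL ℝ (x i)) w := by
    intro i
    have h2 : HasFDerivAt (fun w : EuclideanSpace ℝ (Fin d) => ⟪w, x i⟫_ℝ - y i)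
        (innerSL ℝ (x i)) w := by
      have := ((innerSL ℝ (x i)).hasFDerivAt (x := w)).sub_const (y i)
      refine this.congr_of_eventuallyEq (Filter.Eventually.of_forall fun w => ?_)
      simp [real_inner_comm]
    exact (hasDerivAt_phi_sq hα _).comp_hasFDerivAt w h2
  have h3 : HasFDerivAt (truncatedLoss α x y)
      ((1 / (2 * (n : ℝ))) • ∑ i, (2 * influence α (⟪w, x i⟫_ℝ - y i)) • innerSL ℝ (x i)) w :=
    (HasFDerivAt.fun_sum fun i _ => h1 i).const_mul _
  have h4 : ⟪gradient (truncatedLoss α x y) w, v⟫_ℝ = fderiv ℝ (truncatedLoss α x y) w v :=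
    inner_gradient_left
  rw [h4, h3.fderiv]
  simp only [smul_apply, sum_apply, smul_eq_mul,
    innerSL_apply_apply, Finset.mul_sum, real_inner_comm v]
  refine Finset.sum_congr rfl fun i _ => ?_
  ring

/-! ### Covariance, moments and contamination -/

/-- Subtracting the least spectral value times the identity moves the spectrum into [0, ∞), so the
difference is positive semidefinite. -/
lemma minEigenvalue_mul_le_dotProduct {d : ℕ} {A : Matrix (Fin d) (Fin d) ℝ} (hA : A.IsHermitian)
    (p : Fin d → ℝ) : minEigenvalue A * (p ⬝ᵥ p) ≤ p ⬝ᵥ (A.mulVec p) := by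
  have hfin : (spectrum ℝ A).Finite := by
    rw [hA.spectrum_real_eq_range_eigenvalues]; exact Set.finite_range _
  have hpsd : (-algebraMap ℝ (Matrix (Fin d) (Fin d) ℝ) (minEigenvalue A) + A).PosSemidef := by
    refine Matrix.posSemidef_iff_isHermitian_and_spectrum_nonneg.2 ⟨?_, fun r hr => ?_⟩
    · refine Matrix.IsHermitian.add ?_ hA
      rw [Matrix.algebraMap_eq_diagonal]
      exact (Matrix.isHermitian_diagonal _).neg
    · rw [← spectrum.add_mem_iff] at hr
      have : minEigenvalue A ≤ r + minEigenvalue A := csInf_le hfin.bddBelow hr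
      change 0 ≤ r
      linarith
  have h := hpsd.dotProduct_mulVec_nonneg p
  rw [Matrix.add_mulVec, dotProduct_add, Matrix.neg_mulVec, dotProduct_neg,
    Algebra.algebraMap_eq_smul_one, Matrix.smul_mulVec, Matrix.one_mulVec, dotProduct_smul,
    smul_eq_mul] at h
  simp only [star_trivial] at h
  linarith

section Moments

variable {Ω : Type*} [MeasurableSpace Ω] {μ : Measure Ω} {d : ℕ}
  {X : Ω → EuclideanSpace ℝ (Fin d)} {σ : ℝ≥0}

lemma IsSubGaussianVector.memLp_apply (h : IsSubGaussianVector X σ μ) (j : Fin d) (q : ℝ≥0) :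
    MemLp (fun ω => X ω j) q μ := by
  have h1 := (h (EuclideanSpace.single j 1)).memLp q
  simpa [EuclideanSpace.inner_single_left] using h1

lemma IsSubGaussianVector.integrable_inner_sq (h : IsSubGaussianVector X σ μ)
    (p : EuclideanSpace ℝ (Fin d)) : Integrable (fun ω => ⟪p, X ω⟫_ℝ ^ 2) μ :=
  ((h p).memLp 2).integrable_sq

variable [IsProbabilityMeasure μ]

/-- The quadratic form of the covariance matrix is the variance of ⟨p, X⟩, which is at most its
second moment. -/
lemma IsSubGaussianVector.minEigenvalue_mul_le (h : IsSubGaussianVector X σ μ)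
    (hX : Measurable X) (p : EuclideanSpace ℝ (Fin d)) :
    minEigenvalue (covarianceMatrix X μ) * ‖p‖ ^ 2 ≤ ∫ ω, ⟪p, X ω⟫_ℝ ^ 2 ∂μ := by
  have hA : (covarianceMatrix X μ).IsHermitian := by
    ext j k
    simp [covarianceMatrix, covariance_comm]
  have h1 := minEigenvalue_mul_le_dotProduct hA p.ofLp
  have h2 : p.ofLp ⬝ᵥ p.ofLp = ‖p‖ ^ 2 := by
    rw [EuclideanSpace.norm_sq_eq]
    simp [dotProduct, sq]
  have hmeas : ∀ j, Measurable fun ω => X ω j := fun j => by fun_prop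
  have h3 : p.ofLp ⬝ᵥ ((covarianceMatrix X μ).mulVec p.ofLp)
      = variance (fun ω => ⟪p, X ω⟫_ℝ) μ := by
    have h4 : (fun ω => ⟪p, X ω⟫_ℝ) = fun ω => ∑ j, p j * X ω j := by
      ext ω
      simp [PiLp.inner_apply, mul_comm]
    have h5 : ∀ j, MemLp (fun ω => p j * X ω j) 2 μ := fun j => (h.memLp_apply j 2).const_mul _
    rw [← covariance_self (by fun_prop), h4, covariance_fun_sum_fun_sum h5 h5]
    simp only [dotProduct, Matrix.mulVec, Finset.mul_sum, covarianceMatrix, Matrix.of_apply]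
    refine Finset.sum_congr rfl fun j _ => Finset.sum_congr rfl fun k _ => ?_
    rw [covariance_const_mul_left, covariance_const_mul_right]
    ring
  rw [h2, h3] at h1
  exact h1.trans (variance_le_expectation_sq (by fun_prop))

lemma IsSubGaussianVector.parameter_le {p : EuclideanSpace ℝ (Fin d)} (hp : ‖p‖ ≤ 1) :
    ((σ ^ 2 * ‖p‖₊ ^ 2 : ℝ≥0) : ℝ) ≤ (σ : ℝ) ^ 2 := by
  push_cast
  have : ‖p‖ ^ 2 ≤ 1 := pow_le_one₀ (norm_nonneg _) hp
  nlinarith [sq_nonneg (σ : ℝ)]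

lemma IsSubGaussianVector.integrable_exp_sq (h : IsSubGaussianVector X σ μ) (hX : Measurable X)
    (hσ : 0 < σ) {p : EuclideanSpace ℝ (Fin d)} (hp : ‖p‖ ≤ 1) :
    Integrable (fun ω => Real.exp (⟪p, X ω⟫_ℝ ^ 2 / (4 * (σ : ℝ) ^ 2))) μ :=
  TruncatedLoss.integrable_exp_sq (by fun_prop) (h p) (by positivity) (parameter_le hp)

lemma IsSubGaussianVector.integral_exp_sq_le (h : IsSubGaussianVector X σ μ) (hX : Measurable X)
    (hσ : 0 < σ) {p : EuclideanSpace ℝ (Fin d)} (hp : ‖p‖ ≤ 1) :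
    ∫ ω, Real.exp (⟪p, X ω⟫_ℝ ^ 2 / (4 * (σ : ℝ) ^ 2)) ∂μ ≤ 2 :=
  TruncatedLoss.integral_exp_sq_le (by fun_prop) (h p) (by positivity) (parameter_le hp)

/-- Exponential moments of a variable dominated by the square of a linear form. -/
lemma IsSubGaussianVector.exp_moment_of_le (h : IsSubGaussianVector X σ μ) (hX : Measurable X)
    (hσ : 0 < σ) {p : EuclideanSpace ℝ (Fin d)} (hp : ‖p‖ ≤ 1) {Z : Ω → ℝ} (hZ : Measurable Z)
    (hle : ∀ ω, Z ω ≤ 20 * ⟪p, X ω⟫_ℝ ^ 2) :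
    Integrable (fun ω => Real.exp (1 / (80 * (σ : ℝ) ^ 2) * Z ω)) μ ∧
      ∫ ω, Real.exp (1 / (80 * (σ : ℝ) ^ 2) * Z ω) ∂μ ≤ 2 := by
  have hpt : ∀ ω, Real.exp (1 / (80 * (σ : ℝ) ^ 2) * Z ω)
      ≤ Real.exp (⟪p, X ω⟫_ℝ ^ 2 / (4 * (σ : ℝ) ^ 2)) := by
    intro ω
    refine Real.exp_le_exp.2 ((mul_le_mul_of_nonneg_left (hle ω) (by positivity)).trans_eq ?_)
    field_simp
    ring
  have hint : Integrable (fun ω => Real.exp (1 / (80 * (σ : ℝ) ^ 2) * Z ω)) μ := by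
    refine (h.integrable_exp_sq hX hσ hp).mono' (by fun_prop)
      (Filter.Eventually.of_forall fun ω => ?_)
    rw [Real.norm_of_nonneg (Real.exp_pos _).le]
    exact hpt ω
  exact ⟨hint, (integral_mono hint (h.integrable_exp_sq hX hσ hp) hpt).trans
    (h.integral_exp_sq_le hX hσ hp)⟩

lemma IsSubGaussianVector.integral_inner_sq_le (h : IsSubGaussianVector X σ μ) (hX : Measurable X)
    (hσ : 0 < σ) {p : EuclideanSpace ℝ (Fin d)} (hp : ‖p‖ ≤ 1) :
    ∫ ω, ⟪p, X ω⟫_ℝ ^ 2 ∂μ ≤ 8 * (σ : ℝ) ^ 2 := by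
  have hσ' : (0 : ℝ) < σ := hσ
  have h1 : ∫ ω, ⟪p, X ω⟫_ℝ ^ 2 ∂μ
      ≤ ∫ ω, 4 * (σ : ℝ) ^ 2 * Real.exp (⟪p, X ω⟫_ℝ ^ 2 / (4 * (σ : ℝ) ^ 2)) ∂μ := by
    refine integral_mono (h.integrable_inner_sq p) ((h.integrable_exp_sq hX hσ hp).const_mul _)
      fun ω => ?_
    have h2 := Real.add_one_le_exp (⟪p, X ω⟫_ℝ ^ 2 / (4 * (σ : ℝ) ^ 2))
    have h3 : ⟪p, X ω⟫_ℝ ^ 2 / (4 * (σ : ℝ) ^ 2)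
        ≤ Real.exp (⟪p, X ω⟫_ℝ ^ 2 / (4 * (σ : ℝ) ^ 2)) := by linarith
    rw [div_le_iff₀ (by positivity)] at h3
    simp only
    linarith
  rw [integral_const_mul] at h1
  nlinarith [h.integral_exp_sq_le hX hσ hp, sq_nonneg (σ : ℝ)]

/-- The left side vanishes unless |z| > τ/4. There z² is absorbed by exp(z²/(8s)), and the remaining
half of the exponent is at least τ²/(128s). The argument is doubled because the net lemma evaluates
at 2p. -/
lemma excess_two_mul_le {s τ : ℝ} (hs : 0 < s) (hτ : 0 ≤ τ) (z : ℝ) :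
    excess (τ / 2) (2 * z)
      ≤ 128 * s * Real.exp (-(τ ^ 2 / (128 * s))) * Real.exp (z ^ 2 / (4 * s)) := by
  rcases le_or_gt |2 * z| (τ / 2) with hz | hz
  · rw [excess_eq_zero hz]; positivity
  · have h1 : (τ / 4) ^ 2 ≤ z ^ 2 := by
      rw [← sq_abs z]
      rw [abs_mul, abs_two] at hz
      exact pow_le_pow_left₀ (by positivity) (by linarith) 2
    have h2 : z ^ 2 / (8 * s) ≤ Real.exp (z ^ 2 / (8 * s)) := by
      linarith [Real.add_one_le_exp (z ^ 2 / (8 * s))]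
    rw [div_le_iff₀ (by positivity)] at h2
    have h3 : Real.exp (z ^ 2 / (8 * s))
        ≤ Real.exp (-(τ ^ 2 / (128 * s))) * Real.exp (z ^ 2 / (4 * s)) := by
      rw [← Real.exp_add]
      refine Real.exp_le_exp.2 ?_
      have h4 : -(τ ^ 2 / (128 * s)) + z ^ 2 / (4 * s) - z ^ 2 / (8 * s)
          = (z ^ 2 - (τ / 4) ^ 2) / (8 * s) := by
        field_simp
        ring
      have h5 : 0 ≤ (z ^ 2 - (τ / 4) ^ 2) / (8 * s) := div_nonneg (by linarith) (by positivity)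
      linarith
    have h6 := excess_le (by positivity : 0 ≤ τ / 2) (2 * z)
    have h7 := mul_le_mul_of_nonneg_left h3 (by positivity : 0 ≤ 128 * s)
    nlinarith

/-- The contribution of one sample to the error of strong monotonicity in the direction `u`, when
noises above `T / 2` and inputs above `τ` are discarded. -/
noncomputable def contamination (T τ : ℝ) (u v : EuclideanSpace ℝ (Fin d)) (e : ℝ) : ℝ :=
  ⟪u, v⟫_ℝ ^ 2 * {e : ℝ | T ^ 2 / 4 ≤ e ^ 2}.indicator 1 e + excess (τ / 2) ⟪u, v⟫_ℝ

lemma measurableSet_large_noise (T : ℝ) : MeasurableSet {e : ℝ | T ^ 2 / 4 ≤ e ^ 2} :=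
  measurableSet_le measurable_const (by fun_prop)

@[fun_prop]
lemma measurable_contamination {Ω' : Type*} [MeasurableSpace Ω']
    {v : Ω' → EuclideanSpace ℝ (Fin d)} {e : Ω' → ℝ} (T τ : ℝ) (u : EuclideanSpace ℝ (Fin d))
    (hv : Measurable v) (he : Measurable e) :
    Measurable fun ω => contamination T τ u (v ω) (e ω) := by
  have h : Measurable ({e : ℝ | T ^ 2 / 4 ≤ e ^ 2}.indicator (1 : ℝ → ℝ)) :=
    measurable_one.indicator (measurableSet_large_noise T)
  unfold contamination
  fun_prop

lemma indicator_one_mem_Icc (S : Set ℝ) (e : ℝ) :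
    0 ≤ S.indicator (1 : ℝ → ℝ) e ∧ S.indicator (1 : ℝ → ℝ) e ≤ 1 := by
  by_cases h : e ∈ S <;> simp [h]

lemma contamination_nonneg (T τ : ℝ) (u v : EuclideanSpace ℝ (Fin d)) (e : ℝ) :
    0 ≤ contamination T τ u v e :=
  add_nonneg (mul_nonneg (sq_nonneg _) (indicator_one_mem_Icc _ e).1) (excess_nonneg _ _)

/-- 20 = 4 + 16: the doubled square, and `excess_le` at the doubled argument. -/
lemma contamination_two_smul_le {T τ : ℝ} (hτ : 0 ≤ τ) (p v : EuclideanSpace ℝ (Fin d)) (e : ℝ) :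
    contamination T τ ((2 : ℝ) • p) v e ≤ 20 * ⟪p, v⟫_ℝ ^ 2 := by
  have h1 := excess_le (by positivity : 0 ≤ τ / 2) (2 * ⟪p, v⟫_ℝ)
  have h2 := (indicator_one_mem_Icc {e : ℝ | T ^ 2 / 4 ≤ e ^ 2} e).2
  unfold contamination
  rw [real_inner_smul_left]
  nlinarith [sq_nonneg ⟪p, v⟫_ℝ]

lemma integral_contamination_le {e : Ω → ℝ} (h : IsSubGaussianVector X σ μ) (hX : Measurable X)
    (he : Measurable e) (hind : IndepFun X e μ) (hσ : 0 < σ) {T τ : ℝ} (hτ : 0 ≤ τ)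
    {p : EuclideanSpace ℝ (Fin d)} (hp : ‖p‖ ≤ 1) :
    ∫ ω, contamination T τ ((2 : ℝ) • p) (X ω) (e ω) ∂μ
      ≤ 256 * (σ : ℝ) ^ 2 * (√(μ.real {ω | T ^ 2 / 4 ≤ e ω ^ 2})
        + Real.exp (-(τ ^ 2 / (128 * (σ : ℝ) ^ 2)))) := by
  have hσ' : (0 : ℝ) < σ := hσ
  set S : Set ℝ := {e : ℝ | T ^ 2 / 4 ≤ e ^ 2} with hS
  have hSm : MeasurableSet S := measurableSet_large_noise T
  set P := μ.real {ω | T ^ 2 / 4 ≤ e ω ^ 2} with hP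
  have hindicator : Measurable (S.indicator (1 : ℝ → ℝ)) := measurable_one.indicator hSm
  have hint1 : Integrable (fun ω => ⟪p, X ω⟫_ℝ ^ 2 * S.indicator (1 : ℝ → ℝ) (e ω)) μ := by
    refine (h.integrable_inner_sq p).mono' (by fun_prop) (Filter.Eventually.of_forall fun ω => ?_)
    have h1 := indicator_one_mem_Icc S (e ω)
    rw [Real.norm_of_nonneg (mul_nonneg (sq_nonneg _) h1.1)]
    exact mul_le_of_le_one_right (sq_nonneg _) h1.2
  have hfactor : ∫ ω, ⟪p, X ω⟫_ℝ ^ 2 * S.indicator (1 : ℝ → ℝ) (e ω) ∂μ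
      = (∫ ω, ⟪p, X ω⟫_ℝ ^ 2 ∂μ) * P := by
    have h1 := hind.integral_fun_comp_mul_comp (f := fun v => ⟪p, v⟫_ℝ ^ 2)
      (g := S.indicator (1 : ℝ → ℝ)) hX.aemeasurable he.aemeasurable
      (by fun_prop) hindicator.aestronglyMeasurable
    rw [h1]
    congr 1
    have h2 : (fun ω => S.indicator (1 : ℝ → ℝ) (e ω)) = (e ⁻¹' S).indicator 1 := by
      ext ω; simp [Set.indicator]
    rw [h2, integral_indicator_one (he hSm)]
    rfl
  have hexp := h.integrable_exp_sq hX hσ hp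
  have hle : ∫ ω, contamination T τ ((2 : ℝ) • p) (X ω) (e ω) ∂μ
      ≤ ∫ ω, (4 * (⟪p, X ω⟫_ℝ ^ 2 * S.indicator (1 : ℝ → ℝ) (e ω))
        + 128 * (σ : ℝ) ^ 2 * Real.exp (-(τ ^ 2 / (128 * (σ : ℝ) ^ 2)))
          * Real.exp (⟪p, X ω⟫_ℝ ^ 2 / (4 * (σ : ℝ) ^ 2))) ∂μ := by
    refine integral_mono_of_nonneg
      (Filter.Eventually.of_forall fun ω => contamination_nonneg _ _ _ _ _)
      ((hint1.const_mul _).add (hexp.const_mul _)) (Filter.Eventually.of_forall fun ω => ?_)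
    simp only [contamination, real_inner_smul_left]
    refine add_le_add (le_of_eq (by ring)) (excess_two_mul_le (by positivity) hτ _)
  rw [integral_add (hint1.const_mul _) (hexp.const_mul _), integral_const_mul, integral_const_mul,
    hfactor] at hle
  have hP0 : 0 ≤ P := measureReal_nonneg
  have hP1 : P ≤ 1 := measureReal_le_one
  -- Independence of noise and input yields P itself; the weaker √P is what the hypothesis of the
  -- theorem controls.
  have hPs : P ≤ √P := Real.le_sqrt_of_sq_le (by nlinarith)
  have h1 : (∫ ω, ⟪p, X ω⟫_ℝ ^ 2 ∂μ) * P ≤ 8 * (σ : ℝ) ^ 2 * √P :=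
    mul_le_mul (h.integral_inner_sq_le hX hσ hp) hPs hP0 (by positivity)
  have h2 := mul_le_mul_of_nonneg_left (h.integral_exp_sq_le hX hσ hp)
    (by positivity : 0 ≤ 128 * (σ : ℝ) ^ 2 * Real.exp (-(τ ^ 2 / (128 * (σ : ℝ) ^ 2))))
  have h3 : 0 ≤ (σ : ℝ) ^ 2 * √P := by positivity
  linarith

/-- The product of a sub-Gaussian variable and an independent bounded variable is
sub-Gaussian. -/
lemma hasSubgaussianMGF_mul_of_indepFun {Y e : Ω → ℝ} {c B : ℝ≥0} (hY : HasSubgaussianMGF Y c μ)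
    (hYm : Measurable Y) (he : Measurable e) (hind : IndepFun Y e μ) (hB : ∀ ω, |e ω| ≤ B) :
    HasSubgaussianMGF (fun ω => e ω * Y ω) (B ^ 2 * c) μ := by
  have hint : ∀ t : ℝ, Integrable (fun ω => Real.exp (t * (e ω * Y ω))) μ := by
    intro t
    refine ((hY.integrable_exp_mul (|t| * B)).add (hY.integrable_exp_mul (-(|t| * B)))).mono'
      (by fun_prop) (Filter.Eventually.of_forall fun ω => ?_)
    rw [Real.norm_of_nonneg (Real.exp_pos _).le]
    have h1 : |t * e ω| ≤ |t| * B := by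
      rw [abs_mul]; exact mul_le_mul_of_nonneg_left (hB ω) (abs_nonneg t)
    have h2 := abs_le.1 h1
    have p1 := Real.exp_pos (|t| * B * Y ω)
    have p2 := Real.exp_pos (-(|t| * B) * Y ω)
    simp only [Pi.add_apply]
    rcases le_total 0 (Y ω) with hy | hy
    · have : Real.exp (t * (e ω * Y ω)) ≤ Real.exp (|t| * B * Y ω) := by
        refine Real.exp_le_exp.2 ?_
        nlinarith
      linarith
    · have : Real.exp (t * (e ω * Y ω)) ≤ Real.exp (-(|t| * B) * Y ω) := by
        refine Real.exp_le_exp.2 ?_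
        nlinarith
      linarith
  refine ⟨hint, fun t => ?_⟩
  have hprod : μ.map (fun ω => (e ω, Y ω)) = (μ.map e).prod (μ.map Y) :=
    (indepFun_iff_map_prod_eq_prod_map_map he.aemeasurable hYm.aemeasurable).1 hind.symm
  have : IsProbabilityMeasure (μ.map e) := Measure.isProbabilityMeasure_map he.aemeasurable
  have : IsProbabilityMeasure (μ.map Y) := Measure.isProbabilityMeasure_map hYm.aemeasurable
  have hF : Measurable fun z : ℝ × ℝ => Real.exp (t * (z.1 * z.2)) := by fun_prop
  have hpair : Measurable fun ω => (e ω, Y ω) := he.prodMk hYm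
  have hintF : Integrable (fun z : ℝ × ℝ => Real.exp (t * (z.1 * z.2)))
      ((μ.map e).prod (μ.map Y)) := by
    rw [← hprod, integrable_map_measure hF.aestronglyMeasurable hpair.aemeasurable]
    exact hint t
  -- By Fubini, fix e = a: the inner integral is the moment generating function of Y at ta, and a² ≤
  -- B² almost surely.
  have h1 : mgf (fun ω => e ω * Y ω) μ t
      = ∫ a, ∫ y, Real.exp (t * (a * y)) ∂(μ.map Y) ∂(μ.map e) := by
    rw [← integral_prod _ hintF, ← hprod,
      integral_map hpair.aemeasurable hF.aestronglyMeasurable]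
    rfl
  rw [h1]
  have hae : ∀ᵐ a ∂(μ.map e), |a| ≤ (B : ℝ) := by
    rw [ae_map_iff he.aemeasurable (measurableSet_le (by fun_prop) measurable_const)]
    exact Filter.Eventually.of_forall hB
  have h2 : ∫ a, ∫ y, Real.exp (t * (a * y)) ∂(μ.map Y) ∂(μ.map e)
      ≤ ∫ _a, Real.exp ((B ^ 2 * c : ℝ≥0) * t ^ 2 / 2) ∂(μ.map e) := by
    refine integral_mono_ae hintF.integral_prod_left (integrable_const _) ?_
    filter_upwards [hae] with a ha
    have h3 : ∫ y, Real.exp (t * (a * y)) ∂(μ.map Y) = mgf Y μ (t * a) := by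
      rw [integral_map hYm.aemeasurable (by fun_prop)]
      simp only [mgf, mul_assoc]
    rw [h3]
    refine (hY.mgf_le (t * a)).trans (Real.exp_le_exp.2 ?_)
    push_cast
    have h4 : a ^ 2 ≤ (B : ℝ) ^ 2 := by rw [← sq_abs a]; exact pow_le_pow_left₀ (abs_nonneg a) ha 2
    have h5 := mul_le_mul_of_nonneg_left h4 (by positivity : (0 : ℝ) ≤ c * t ^ 2)
    nlinarith
  refine h2.trans ?_
  simp

end Moments

/-! ### Deterministic part: from net points to all directions, and to the error bound -/

section Deterministic

variable {d n : ℕ} {x : Fin n → EuclideanSpace ℝ (Fin d)} {e : Fin n → ℝ}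
  {N : Finset (EuclideanSpace ℝ (Fin d))}

lemma convexOn_comp_inner_left {f : ℝ → ℝ} (hf : ConvexOn ℝ Set.univ f)
    (v : EuclideanSpace ℝ (Fin d)) :
    ConvexOn ℝ Set.univ fun u : EuclideanSpace ℝ (Fin d) => f ⟪u, v⟫_ℝ := by
  have h := hf.comp_linearMap (innerSL ℝ v).toLinearMap
  refine h.congr fun u _ => ?_
  simp [real_inner_comm]

lemma convexOn_fintype_sum {ι : Type*} [Fintype ι] {f : ι → EuclideanSpace ℝ (Fin d) → ℝ}
    (hf : ∀ i, ConvexOn ℝ Set.univ (f i)) : ConvexOn ℝ Set.univ fun u => ∑ i, f i u := by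
  refine ⟨convex_univ, fun u _ v _ a b ha hb hab => ?_⟩
  simp only [smul_eq_mul, Finset.mul_sum, ← Finset.sum_add_distrib]
  exact Finset.sum_le_sum fun i _ => (hf i).2 (Set.mem_univ u) (Set.mem_univ v) ha hb hab

lemma sum_inner_sq_le_of_net (hN : ∀ u : EuclideanSpace ℝ (Fin d), ‖u‖ ≤ 1 →
      ∃ p ∈ N, ‖u - p‖ ≤ 1 / 2) {M : ℝ} (hM : ∀ p ∈ N, ∑ i, ⟪p, x i⟫_ℝ ^ 2 ≤ M)
    {u : EuclideanSpace ℝ (Fin d)} (hu : ‖u‖ ≤ 1) : ∑ i, ⟪u, x i⟫_ℝ ^ 2 ≤ 4 * M := by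
  refine convexOn_le_of_net (G := fun u => ∑ i, ⟪u, x i⟫_ℝ ^ 2)
    (convexOn_fintype_sum fun i => convexOn_comp_inner_left (even_two.convexOn_pow) (x i))
    (by fun_prop) hN (fun p hp => ?_) hu
  simp only [real_inner_smul_left, mul_pow, ← Finset.mul_sum]
  linarith [hM p hp]

/-- Each summand is convex in u: the indicator depends only on the noise, and `excess` is convex. -/
lemma sum_contamination_le_of_net {T τ : ℝ} (hN : ∀ u : EuclideanSpace ℝ (Fin d), ‖u‖ ≤ 1 →
      ∃ p ∈ N, ‖u - p‖ ≤ 1 / 2) {M : ℝ}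
    (hM : ∀ p ∈ N, ∑ i, contamination T τ ((2 : ℝ) • p) (x i) (e i) ≤ M)
    {u : EuclideanSpace ℝ (Fin d)} (hu : ‖u‖ ≤ 1) : ∑ i, contamination T τ u (x i) (e i) ≤ M := by
  refine convexOn_le_of_net (G := fun u => ∑ i, contamination T τ u (x i) (e i))
    (convexOn_fintype_sum fun i => ?_) ?_ hN hM hu
  · have h1 := (convexOn_comp_inner_left (even_two.convexOn_pow (𝕜 := ℝ)) (x i)).smul
      (indicator_one_mem_Icc {e : ℝ | T ^ 2 / 4 ≤ e ^ 2} (e i)).1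
    refine (h1.add (convexOn_comp_inner_left (convexOn_excess (τ / 2)) (x i))).congr fun u _ => ?_
    simp only [contamination, Pi.add_apply, smul_eq_mul, mul_comm]
  · unfold contamination
    fun_prop

/-- Convexity transfers only upper bounds. A lower bound comes from Q(p) ≤ 2Q(u) + 2Q(u − p), where
Q(u − p) is made small by a fine net and the upper bound on the ball. Numerically, (0.81 − 0.05 −
0.16)/2 = 0.3. -/
lemma sum_inner_sq_ge_of_net {lam S δ : ℝ} (hlam : 0 < lam) (hδ : 0 < δ) (hδ1 : δ ≤ 1 / 10)
    (hδS : δ ^ 2 * (4 * S) ≤ 2 / 25 * lam)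
    (hN : ∀ u : EuclideanSpace ℝ (Fin d), ‖u‖ ≤ 1 → ∃ p ∈ N, ‖u - p‖ ≤ δ)
    (hlow : ∀ p ∈ N, n * (lam * ‖p‖ ^ 2 - lam / 20) ≤ ∑ i, ⟪p, x i⟫_ℝ ^ 2)
    (hup : ∀ p ∈ N, ∑ i, ⟪p, x i⟫_ℝ ^ 2 ≤ n * S) {u : EuclideanSpace ℝ (Fin d)} (hu : ‖u‖ = 1) :
    n * (3 / 10 * lam) ≤ ∑ i, ⟪u, x i⟫_ℝ ^ 2 := by
  obtain ⟨p, hp, hup'⟩ := hN u hu.le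
  have h1 : ∑ i, ⟪u - p, x i⟫_ℝ ^ 2 ≤ n * (2 / 25 * lam) := by
    have h2 : ‖(δ⁻¹ : ℝ) • (u - p)‖ ≤ 1 := by
      rw [norm_smul, Real.norm_of_nonneg (by positivity), inv_mul_le_iff₀ hδ]
      simpa using hup'
    have h3 := sum_inner_sq_le_of_net (x := x)
      (fun u hu => (hN u hu).imp fun p hp => ⟨hp.1, hp.2.trans (by linarith)⟩) hup h2
    simp only [real_inner_smul_left, mul_pow, ← Finset.mul_sum] at h3
    rw [inv_pow, inv_mul_le_iff₀ (by positivity)] at h3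
    have h4 := mul_le_mul_of_nonneg_left hδS (Nat.cast_nonneg (α := ℝ) n)
    linarith
  have h5 : (9 / 10 : ℝ) ≤ ‖p‖ := by
    have := norm_sub_norm_le u p
    linarith
  have h6 : (81 / 100 : ℝ) ≤ ‖p‖ ^ 2 := by nlinarith
  have h7 : ∑ i, ⟪p, x i⟫_ℝ ^ 2 ≤ ∑ i, (2 * ⟪u, x i⟫_ℝ ^ 2 + 2 * ⟪u - p, x i⟫_ℝ ^ 2) := by
    refine Finset.sum_le_sum fun i _ => ?_
    rw [inner_sub_left]
    nlinarith [sq_nonneg (2 * ⟪u, x i⟫_ℝ - ⟪p, x i⟫_ℝ)]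
  rw [Finset.sum_add_distrib, ← Finset.mul_sum, ← Finset.mul_sum] at h7
  have h8 := hlow p hp
  have h9 : (n : ℝ) * (lam * (81 / 100) - lam / 20) ≤ n * (lam * ‖p‖ ^ 2 - lam / 20) := by
    refine mul_le_mul_of_nonneg_left ?_ (Nat.cast_nonneg n)
    nlinarith
  linarith

/-- Monotonicity of one summand of the gradient along a direction of length `ρ ≤ r`. -/
lemma influence_mul_ge {α T r ρ s e : ℝ} (hα : 0 < α) (hT0 : 0 < T) (hT : T ≤ √α / 2)
    (hρ : 0 < ρ) (hr : ρ ≤ r) {u v : EuclideanSpace ℝ (Fin d)} (hs : s = ρ * ⟪u, v⟫_ℝ) :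
    ρ ^ 2 * (2 / 5 * ⟪u, v⟫_ℝ ^ 2 - contamination T (T / (2 * r)) u v e) + influence α (-e) * s
      ≤ influence α (s - e) * s := by
  have h1 := influence_increment_ge (s := s) (e := e) hα hT
  have h2 : (if T ^ 2 / 4 ≤ e ^ 2 then s ^ 2 else 0)
      = ρ ^ 2 * (⟪u, v⟫_ℝ ^ 2 * {e : ℝ | T ^ 2 / 4 ≤ e ^ 2}.indicator 1 e) := by
    by_cases h : T ^ 2 / 4 ≤ e ^ 2
    · simp [Set.indicator, h, hs, mul_pow]
    · simp [Set.indicator, h]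
  have h3 : (if T / 2 < |s| then s ^ 2 else 0)
      ≤ ρ ^ 2 * excess (T / (2 * r) / 2) ⟪u, v⟫_ℝ := by
    split_ifs with h
    · rw [hs, mul_pow]
      refine mul_le_mul_of_nonneg_left (sq_le_excess ?_) (sq_nonneg ρ)
      rw [hs, abs_mul, abs_of_pos hρ] at h
      have hr0 : 0 < r := hρ.trans_le hr
      -- Since ρ ≤ r, |s| > T/2 forces |⟨u,v⟩| > T/(2r), a threshold independent of ρ; hence τ =
      -- T/(2r).
      have h4 : 2 * (T / (2 * r) / 2) = T / 2 / r := by field_simp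
      rw [h4, div_le_iff₀ hr0]
      nlinarith [abs_nonneg ⟪u, v⟫_ℝ]
    · exact mul_nonneg (sq_nonneg ρ) (excess_nonneg _ _)
  have h5 : 2 / 5 * s ^ 2 = ρ ^ 2 * (2 / 5 * ⟪u, v⟫_ℝ ^ 2) := by rw [hs]; ring
  unfold contamination
  nlinarith

lemma norm_le_sqrt_mul_of_abs_apply_le {u : EuclideanSpace ℝ (Fin d)} {b : ℝ} (hb : 0 ≤ b)
    (h : ∀ j, |u j| ≤ b) : ‖u‖ ≤ √d * b := by
  rw [EuclideanSpace.norm_eq]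
  refine Real.sqrt_le_iff.2 ⟨by positivity, ?_⟩
  calc ∑ j, ‖u j‖ ^ 2 ≤ ∑ _j : Fin d, b ^ 2 :=
        Finset.sum_le_sum fun j _ => pow_le_pow_left₀ (norm_nonneg _) (h j) 2
    _ = (√d * b) ^ 2 := by
        rw [Finset.sum_const, Finset.card_univ, Fintype.card_fin, nsmul_eq_mul, mul_pow,
          Real.sq_sqrt (Nat.cast_nonneg d)]

/-- Approximate stationary points of the truncated loss are close to the truth, on a sample whose
empirical second moment is bounded below, whose contamination is small, and whose noise gradient
is small. -/
lemma norm_sub_le_of_gradient_le {α T r tol lam θ : ℝ} (hn : 0 < n) (hα : 0 < α) (hT0 : 0 < T)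
    (hT : T ≤ √α / 2) (hlam : 0 < lam) (hθ : 0 ≤ θ)
    (hlow : ∀ u : EuclideanSpace ℝ (Fin d), ‖u‖ = 1 →
      n * (3 / 10 * lam) ≤ ∑ i, ⟪u, x i⟫_ℝ ^ 2)
    (hcont : ∀ u : EuclideanSpace ℝ (Fin d), ‖u‖ = 1 →
      ∑ i, contamination T (T / (2 * r)) u (x i) (e i) ≤ n * (lam / 100))
    (hnoise : ∀ j, |∑ i, influence α (-e i) * x i j| ≤ n * θ)
    {w wstar : EuclideanSpace ℝ (Fin d)} (hw : ‖w - wstar‖ ≤ r)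
    (hgrad : ‖gradient (truncatedLoss α x fun i => ⟪wstar, x i⟫_ℝ + e i) w‖ ≤ tol) :
    lam / 10 * ‖w - wstar‖ ≤ tol + √d * θ := by
  set v := w - wstar with hv
  set ρ := ‖v‖ with hρdef
  have htol : 0 ≤ tol := (norm_nonneg _).trans hgrad
  rcases (norm_nonneg v).eq_or_lt with h0 | hρ
  · rw [hρdef, ← h0, mul_zero]; positivity
  have hn' : (0 : ℝ) < n := by exact_mod_cast hn
  set u : EuclideanSpace ℝ (Fin d) := (ρ⁻¹ : ℝ) • v with hu
  have hu1 : ‖u‖ = 1 := by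
    rw [hu, norm_smul, norm_inv, norm_norm, inv_mul_cancel₀ hρ.ne']
  have hs : ∀ i, ⟪v, x i⟫_ℝ = ρ * ⟪u, x i⟫_ℝ := fun i => by
    rw [hu, real_inner_smul_left, mul_inv_cancel_left₀ hρ.ne']
  have h1 := inner_gradient_truncatedLoss hα x (fun i => ⟪wstar, x i⟫_ℝ + e i) w v
  have h2 : ∀ i, ⟪w, x i⟫_ℝ - (⟪wstar, x i⟫_ℝ + e i) = ⟪v, x i⟫_ℝ - e i := fun i => by
    rw [hv, inner_sub_left]; ring
  simp only [h2] at h1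
  have h3 : ∑ i, influence α (⟪v, x i⟫_ℝ - e i) * ⟪v, x i⟫_ℝ ≤ n * (tol * ρ) := by
    have h4 := (real_inner_le_norm _ _).trans (mul_le_mul_of_nonneg_right hgrad (norm_nonneg v))
    rw [h1, one_div, inv_mul_le_iff₀ hn'] at h4
    exact h4
  have h5 : ρ ^ 2 * (2 / 5 * ∑ i, ⟪u, x i⟫_ℝ ^ 2
        - ∑ i, contamination T (T / (2 * r)) u (x i) (e i))
        + ∑ i, influence α (-e i) * ⟪v, x i⟫_ℝ
      ≤ ∑ i, influence α (⟪v, x i⟫_ℝ - e i) * ⟪v, x i⟫_ℝ := by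
    rw [Finset.mul_sum, ← Finset.sum_sub_distrib, Finset.mul_sum, ← Finset.sum_add_distrib]
    exact Finset.sum_le_sum fun i _ => influence_mul_ge hα hT0 hT hρ hw (hs i)
  have h6 : -(ρ * (√d * (n * θ))) ≤ ∑ i, influence α (-e i) * ⟪v, x i⟫_ℝ := by
    have h7 : ∑ i, influence α (-e i) * ⟪v, x i⟫_ℝ = ⟪v, ∑ i, influence α (-e i) • x i⟫_ℝ := by
      simp only [inner_sum, inner_smul_right]
    have h8 : ‖∑ i, influence α (-e i) • x i‖ ≤ √d * (n * θ) := by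
      refine norm_le_sqrt_mul_of_abs_apply_le (by positivity) fun j => ?_
      simpa using hnoise j
    rw [h7]
    have h9 := (abs_le.1 (abs_real_inner_le_norm v (∑ i, influence α (-e i) • x i))).1
    have h10 := mul_le_mul_of_nonneg_left h8 hρ.le
    linarith
  -- 2/5 · 3/10 − 1/100 = 11/100, which exceeds 1/10.
  have h11 : n * (lam / 10) ≤ 2 / 5 * ∑ i, ⟪u, x i⟫_ℝ ^ 2
      - ∑ i, contamination T (T / (2 * r)) u (x i) (e i) := by
    have := hlow u hu1
    have := hcont u hu1
    have : 0 < n * lam := by positivity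
    linarith
  have h12 := mul_le_mul_of_nonneg_left h11 (sq_nonneg ρ)
  have h13 : (n * ρ) * (lam / 10 * ρ) ≤ (n * ρ) * (tol + √d * θ) := by nlinarith
  exact le_of_mul_le_mul_left h13 (by positivity)

end Deterministic

/-! ### Probabilities of the bad events at one point or coordinate -/

section Events

variable {Ω : Type*} [MeasurableSpace Ω] {μ : Measure Ω} [IsProbabilityMeasure μ] {d n : ℕ}
  {x : Fin n → Ω → EuclideanSpace ℝ (Fin d)} {ε : Fin n → Ω → ℝ} {σ : ℝ≥0}

lemma measureReal_sum_inner_sq_le (hs : IsRegressionSample x ε μ)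
    (hx : ∀ i, IsSubGaussianVector (x i) σ μ) (hσ : 0 < σ) {m t : ℝ} (ht : 0 < t)
    {p : EuclideanSpace ℝ (Fin d)} (hp : ‖p‖ ≤ 1) (hm : ∀ i, m ≤ ∫ ω, ⟪p, x i ω⟫_ℝ ^ 2 ∂μ) :
    μ.real {ω | ∑ i, ⟪p, x i ω⟫_ℝ ^ 2 ≤ n * (m - t)}
      ≤ Real.exp (-(n * chernoffRate (1 / (80 * (σ : ℝ) ^ 2)) t)) := by
  have hmeas : ∀ i, Measurable fun ω => ⟪p, x i ω⟫_ℝ ^ 2 := fun i => by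
    have := hs.measurable_input i
    fun_prop
  have hexp := fun i => (hx i).exp_moment_of_le (hs.measurable_input i) hσ hp (hmeas i)
    fun ω => by nlinarith [sq_nonneg ⟪p, x i ω⟫_ℝ]
  exact measureReal_sum_le_le (Z := fun i ω => ⟪p, x i ω⟫_ℝ ^ 2) (by positivity) ht hmeas
    (fun i ω => sq_nonneg _) (hs.indep_sample.comp (fun _ z => ⟪p, z.1⟫_ℝ ^ 2)
      fun _ => by fun_prop) (fun i => (hexp i).1) (fun i => (hexp i).2) hm

lemma measureReal_sum_inner_sq_ge (hs : IsRegressionSample x ε μ)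
    (hx : ∀ i, IsSubGaussianVector (x i) σ μ) (hσ : 0 < σ) {t : ℝ} (ht : 0 < t)
    {p : EuclideanSpace ℝ (Fin d)} (hp : ‖p‖ ≤ 1) :
    μ.real {ω | n * (8 * (σ : ℝ) ^ 2 + t) ≤ ∑ i, ⟪p, x i ω⟫_ℝ ^ 2}
      ≤ Real.exp (-(n * chernoffRate (1 / (80 * (σ : ℝ) ^ 2)) t)) := by
  have hmeas : ∀ i, Measurable fun ω => ⟪p, x i ω⟫_ℝ ^ 2 := fun i => by
    have := hs.measurable_input i
    fun_prop
  have hexp := fun i => (hx i).exp_moment_of_le (hs.measurable_input i) hσ hp (hmeas i)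
    fun ω => by nlinarith [sq_nonneg ⟪p, x i ω⟫_ℝ]
  exact measureReal_sum_ge_le (Z := fun i ω => ⟪p, x i ω⟫_ℝ ^ 2) (by positivity) ht hmeas
    (fun i ω => sq_nonneg _) (hs.indep_sample.comp (fun _ z => ⟪p, z.1⟫_ℝ ^ 2)
      fun _ => by fun_prop) (fun i => (hexp i).1) (fun i => (hexp i).2)
    fun i => (hx i).integral_inner_sq_le (hs.measurable_input i) hσ hp

lemma measureReal_sum_contamination_ge (hs : IsRegressionSample x ε μ)
    (hx : ∀ i, IsSubGaussianVector (x i) σ μ) (hσ : 0 < σ) {T τ m t : ℝ} (hτ : 0 ≤ τ) (ht : 0 < t)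
    (hm : ∀ i, 256 * (σ : ℝ) ^ 2 * (√(μ.real {ω | T ^ 2 / 4 ≤ ε i ω ^ 2})
        + Real.exp (-(τ ^ 2 / (128 * (σ : ℝ) ^ 2)))) ≤ m)
    {p : EuclideanSpace ℝ (Fin d)} (hp : ‖p‖ ≤ 1) :
    μ.real {ω | n * (m + t) ≤ ∑ i, contamination T τ ((2 : ℝ) • p) (x i ω) (ε i ω)}
      ≤ Real.exp (-(n * chernoffRate (1 / (80 * (σ : ℝ) ^ 2)) t)) := by
  have hmeas : ∀ i, Measurable fun ω => contamination T τ ((2 : ℝ) • p) (x i ω) (ε i ω) :=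
    fun i => measurable_contamination T τ _ (hs.measurable_input i) (hs.measurable_noise i)
  have hexp := fun i => (hx i).exp_moment_of_le (hs.measurable_input i) hσ hp (hmeas i)
    fun ω => contamination_two_smul_le hτ p _ _
  exact measureReal_sum_ge_le
    (Z := fun i ω => contamination T τ ((2 : ℝ) • p) (x i ω) (ε i ω)) (by positivity) ht hmeas
    (fun i ω => contamination_nonneg _ _ _ _ _)
    (hs.indep_sample.comp (fun _ z => contamination T τ ((2 : ℝ) • p) z.1 z.2)
      fun _ => measurable_contamination T τ _ measurable_fst measurable_snd)
    (fun i => (hexp i).1) (fun i => (hexp i).2)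
    fun i => (integral_contamination_le (hx i) (hs.measurable_input i) (hs.measurable_noise i)
      (hs.indep_noise i) hσ hτ hp).trans (hm i)

/-- Coordinatewise concentration of the gradient of the loss at the truth. -/
lemma measureReal_noise_ge (hs : IsRegressionSample x ε μ)
    (hx : ∀ i, IsSubGaussianVector (x i) σ μ) (hσ : 0 < σ) {α L : ℝ} (hα : 0 < α) (hL : 0 ≤ L)
    (hn : 0 < n) (j : Fin d) :
    μ.real {ω | n * (2 * σ * √(α * L / n)) ≤ |∑ i, influence α (-ε i ω) * x i ω j|}
      ≤ 2 * Real.exp (-(2 * L)) := by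
  have hσ' : (0 : ℝ) < σ := hσ
  have hn' : (0 : ℝ) < n := by exact_mod_cast hn
  set B : ℝ≥0 := ⟨√α, Real.sqrt_nonneg α⟩ with hB
  have hBsq : ((B ^ 2 * σ ^ 2 : ℝ≥0) : ℝ) = α * (σ : ℝ) ^ 2 := by
    push_cast
    rw [show (B : ℝ) = √α from rfl, Real.sq_sqrt hα.le]
  have hsub : ∀ i, HasSubgaussianMGF (fun ω => influence α (-ε i ω) * x i ω j)
      (B ^ 2 * σ ^ 2) μ := by
    intro i
    have hxi := hs.measurable_input i
    have hεi := hs.measurable_noise i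
    have h1 : HasSubgaussianMGF (fun ω => x i ω j) (σ ^ 2) μ := by
      have := hx i (EuclideanSpace.single j 1)
      simpa [EuclideanSpace.inner_single_left] using this
    refine hasSubgaussianMGF_mul_of_indepFun h1 (by fun_prop) (by fun_prop) ?_
      fun ω => abs_influence_le hα _
    exact (hs.indep_noise i).comp (φ := fun v => v j) (ψ := fun e => influence α (-e))
      (by fun_prop) (by fun_prop)
  have hind : iIndepFun (fun i ω => influence α (-ε i ω) * x i ω j) μ :=
    hs.indep_sample.comp (fun _ z => influence α (-z.2) * z.1 j) fun _ => by fun_prop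
  have hind' : iIndepFun (fun i ω => -(influence α (-ε i ω) * x i ω j)) μ :=
    hs.indep_sample.comp (fun _ z => -(influence α (-z.2) * z.1 j)) fun _ => by fun_prop
  have hθ : 0 ≤ n * (2 * σ * √(α * L / n)) := by positivity
  -- The sum has variance proxy nασ². The exponent 2L, with L = log d later, pays for a union over d
  -- coordinates and leaves 1/d.
  have hexp : -(n * (2 * σ * √(α * L / n))) ^ 2 / (2 * (n * (α * (σ : ℝ) ^ 2))) = -(2 * L) := by
    rw [mul_pow, mul_pow, Real.sq_sqrt (by positivity)]
    field_simp
  have h1 := HasSubgaussianMGF.measure_sum_ge_le_of_iIndepFun hind (s := Finset.univ)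
    (fun i _ => hsub i) hθ
  have h2 := HasSubgaussianMGF.measure_sum_ge_le_of_iIndepFun hind' (s := Finset.univ)
    (fun i _ => (hsub i).neg) hθ
  have hsum : ((∑ _i : Fin n, (B ^ 2 * σ ^ 2 : ℝ≥0) : ℝ≥0) : ℝ) = n * (α * (σ : ℝ) ^ 2) := by
    rw [Finset.sum_const, Finset.card_univ, Fintype.card_fin, nsmul_eq_mul, NNReal.coe_mul, hBsq,
      NNReal.coe_natCast]
  rw [hsum, hexp] at h1 h2
  have hsubset : {ω | n * (2 * σ * √(α * L / n)) ≤ |∑ i, influence α (-ε i ω) * x i ω j|}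
      ⊆ {ω | n * (2 * σ * √(α * L / n)) ≤ ∑ i, influence α (-ε i ω) * x i ω j}
        ∪ {ω | n * (2 * σ * √(α * L / n)) ≤ ∑ i, -(influence α (-ε i ω) * x i ω j)} := by
    intro ω hω
    rcases le_abs.1 hω.out with h | h
    · exact Or.inl h
    · refine Or.inr ?_
      simpa only [Set.mem_ofPred_eq, Finset.sum_neg_distrib] using h
  refine (measureReal_mono hsubset).trans ((measureReal_union_le _ _).trans ?_)
  linarith

end Events

/-! ### Union bounds and the good event -/

/-- For d ≥ 2 the constant log(3/δ) is absorbed into a multiple of log d. -/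
lemma net_card_le_exp {d : ℕ} (hd : 2 ≤ d) {δ : ℝ} (hδ : 0 < δ) (hδ1 : δ ≤ 1) :
    (3 * √d / δ) ^ d ≤ Real.exp ((1 + Real.log (3 / δ) / Real.log 2) * (d * Real.log d)) := by
  have hd' : (2 : ℝ) ≤ d := by exact_mod_cast hd
  have hpos : 0 < 3 * √d / δ := by positivity
  have hlog2 : 0 < Real.log 2 := Real.log_pos one_lt_two
  have hlog : Real.log 2 ≤ Real.log d := Real.log_le_log two_pos hd'
  have hδlog : 0 ≤ Real.log (3 / δ) :=
    Real.log_nonneg ((one_le_div hδ).2 (by linarith))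
  have h1 : Real.log (3 * √d / δ) ≤ (1 + Real.log (3 / δ) / Real.log 2) * Real.log d := by
    have h2 : 3 * √d / δ = 3 / δ * √d := by ring
    have h3 : Real.log √d ≤ Real.log d := by
      rw [Real.log_sqrt (by positivity)]; linarith
    have h4 : Real.log (3 / δ) ≤ Real.log (3 / δ) / Real.log 2 * Real.log d := by
      rw [div_mul_eq_mul_div, le_div_iff₀ hlog2]
      exact mul_le_mul_of_nonneg_left hlog hδlog
    rw [h2, Real.log_mul (by positivity) (by positivity)]
    linarith
  rw [← Real.exp_log hpos, ← Real.exp_nat_mul]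
  refine Real.exp_le_exp.2 ?_
  have := mul_le_mul_of_nonneg_left h1 (by positivity : (0 : ℝ) ≤ d)
  linarith

section Main

variable {Ω : Type*} [MeasurableSpace Ω] {μ : Measure Ω}

lemma measureReal_iUnion_net_le {E : Type*} {N : Finset E} {f : E → Set Ω} {d n K κ : ℝ}
    (hd : 2 ≤ d) (hN : (N.card : ℝ) ≤ Real.exp (K * (d * Real.log d)))
    (hn : (K + 1) * (d * Real.log d) ≤ n * κ)
    (hf : ∀ p ∈ N, μ.real (f p) ≤ Real.exp (-(n * κ))) :
    μ.real (⋃ p ∈ N, f p) ≤ Real.exp (-Real.log d) := by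
  have hlog : 0 ≤ Real.log d := Real.log_nonneg (by linarith)
  refine (measureReal_biUnion_finset_le N f).trans ((Finset.sum_le_card_nsmul N _ _ hf).trans ?_)
  rw [nsmul_eq_mul]
  refine (mul_le_mul_of_nonneg_right hN (Real.exp_pos _).le).trans ?_
  rw [← Real.exp_add]
  refine Real.exp_le_exp.2 ?_
  nlinarith

variable [IsProbabilityMeasure μ]

/-- With high probability, all approximate stationary points in the ball of radius `r` around the
truth are close to it. -/
lemma exists_event_norm_sub_le {σ : ℝ≥0} {lam δ : ℝ} (hσ : 0 < σ) (hlam : 0 < lam)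
    (hδ : 0 < δ) (hδ1 : δ ≤ 1 / 10)
    (hδS : δ ^ 2 * (4 * (8 * (σ : ℝ) ^ 2 + lam / 20)) ≤ 2 / 25 * lam) {d n : ℕ} (hd : 2 ≤ d)
    (hn : 0 < n)
    (hrate₁ : (1 + Real.log (3 / δ) / Real.log 2 + 1) * (d * Real.log d)
      ≤ n * chernoffRate (1 / (80 * (σ : ℝ) ^ 2)) (lam / 20))
    (hrate₂ : (1 + Real.log (3 / δ) / Real.log 2 + 1) * (d * Real.log d)
      ≤ n * chernoffRate (1 / (80 * (σ : ℝ) ^ 2)) (lam / 200))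
    {x : Fin n → Ω → EuclideanSpace ℝ (Fin d)} {ε : Fin n → Ω → ℝ}
    (wstar : EuclideanSpace ℝ (Fin d)) (hs : IsRegressionSample x ε μ)
    (hx : ∀ i, IsSubGaussianVector (x i) σ μ)
    (hmin : ∀ i, minEigenvalue (covarianceMatrix (x i) μ) = lam)
    {α T r tol : ℝ} (hα : 0 < α) (hT0 : 0 < T) (hT : T ≤ √α / 2) (hr : 0 < r)
    (hcont : ∀ i, 256 * (σ : ℝ) ^ 2 * (√(μ.real {ω | T ^ 2 / 4 ≤ ε i ω ^ 2})
        + Real.exp (-((T / (2 * r)) ^ 2 / (128 * (σ : ℝ) ^ 2)))) ≤ lam / 200) :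
    ∃ E : Set Ω, MeasurableSet E ∧ 1 - 5 * Real.exp (-Real.log d) ≤ μ.real E ∧
      ∀ ω ∈ E, ∀ w : EuclideanSpace ℝ (Fin d), ‖w - wstar‖ ≤ r →
        ‖gradient (truncatedLoss α (fun i => x i ω)
            (fun i => ⟪wstar, x i ω⟫_ℝ + ε i ω)) w‖ ≤ tol →
        lam / 10 * ‖w - wstar‖ ≤ tol + √d * (2 * σ * √(α * Real.log d / n)) := by
  have hd' : (2 : ℝ) ≤ d := by exact_mod_cast hd
  have hlog : 0 ≤ Real.log d := Real.log_nonneg (by linarith)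
  have hxm := hs.measurable_input
  have hεm := hs.measurable_noise
  obtain ⟨N, hN1, hN, hNcard⟩ := exists_finset_net (by omega : 0 < d) hδ (by linarith)
  have hNhalf : ∀ u : EuclideanSpace ℝ (Fin d), ‖u‖ ≤ 1 → ∃ p ∈ N, ‖u - p‖ ≤ 1 / 2 :=
    fun u hu => (hN u hu).imp fun p hp => ⟨hp.1, hp.2.trans (by linarith)⟩
  have hNexp := hNcard.trans (net_card_le_exp hd hδ (by linarith))
  let low (p : EuclideanSpace ℝ (Fin d)) : Set Ω :=
    {ω | ∑ i, ⟪p, x i ω⟫_ℝ ^ 2 ≤ n * (lam * ‖p‖ ^ 2 - lam / 20)}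
  let up (p : EuclideanSpace ℝ (Fin d)) : Set Ω :=
    {ω | n * (8 * (σ : ℝ) ^ 2 + lam / 20) ≤ ∑ i, ⟪p, x i ω⟫_ℝ ^ 2}
  -- One λ/200 bounds the mean, the other is the deviation.
  let large (p : EuclideanSpace ℝ (Fin d)) : Set Ω :=
    {ω | n * (lam / 200 + lam / 200)
      ≤ ∑ i, contamination T (T / (2 * r)) ((2 : ℝ) • p) (x i ω) (ε i ω)}
  let noise (j : Fin d) : Set Ω :=
    {ω | n * (2 * σ * √(α * Real.log d / n)) ≤ |∑ i, influence α (-ε i ω) * x i ω j|}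
  have hlowm : MeasurableSet (⋃ p ∈ N, low p) := N.measurableSet_biUnion fun p _ =>
    measurableSet_le (by fun_prop) measurable_const
  have hupm : MeasurableSet (⋃ p ∈ N, up p) := N.measurableSet_biUnion fun p _ =>
    measurableSet_le measurable_const (by fun_prop)
  have hlargem : MeasurableSet (⋃ p ∈ N, large p) := N.measurableSet_biUnion fun p _ =>
    measurableSet_le measurable_const (Finset.measurable_sum _ fun i _ =>
      measurable_contamination T _ _ (hxm i) (hεm i))
  have hnoisem : MeasurableSet (⋃ j, noise j) := MeasurableSet.iUnion fun j =>
    measurableSet_le measurable_const (by fun_prop)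
  have hlow : μ.real (⋃ p ∈ N, low p) ≤ Real.exp (-Real.log d) :=
    measureReal_iUnion_net_le hd' hNexp hrate₁ fun p hp =>
      measureReal_sum_inner_sq_le hs hx hσ (by positivity) (hN1 p hp) fun i => by
        rw [← hmin i]; exact (hx i).minEigenvalue_mul_le (hxm i) p
  have hup : μ.real (⋃ p ∈ N, up p) ≤ Real.exp (-Real.log d) :=
    measureReal_iUnion_net_le hd' hNexp hrate₁ fun p hp =>
      measureReal_sum_inner_sq_ge hs hx hσ (by positivity) (hN1 p hp)
  have hlarge : μ.real (⋃ p ∈ N, large p) ≤ Real.exp (-Real.log d) :=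
    measureReal_iUnion_net_le hd' hNexp hrate₂ fun p hp =>
      measureReal_sum_contamination_ge hs hx hσ (by positivity) (by positivity) hcont (hN1 p hp)
  have hnoise : μ.real (⋃ j, noise j) ≤ 2 * Real.exp (-Real.log d) := by
    refine (measureReal_iUnion_fintype_le _).trans ((Finset.sum_le_card_nsmul _ _ _ fun j _ =>
      measureReal_noise_ge hs hx hσ hα hlog hn j).trans_eq ?_)
    rw [nsmul_eq_mul, Finset.card_univ, Fintype.card_fin,
      show -(2 * Real.log d) = -Real.log d + -Real.log d by ring, Real.exp_add, Real.exp_neg,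
      Real.exp_log (by linarith)]
    field_simp
  refine ⟨((⋃ p ∈ N, low p) ∪ (⋃ p ∈ N, up p) ∪ ((⋃ p ∈ N, large p) ∪ ⋃ j, noise j))ᶜ,
    ((hlowm.union hupm).union (hlargem.union hnoisem)).compl, ?_, fun ω hω w hw hgrad => ?_⟩
  · rw [probReal_compl_eq_one_sub ((hlowm.union hupm).union (hlargem.union hnoisem))]
    have h1 := measureReal_union_le (μ := μ) ((⋃ p ∈ N, low p) ∪ (⋃ p ∈ N, up p))
      ((⋃ p ∈ N, large p) ∪ ⋃ j, noise j)
    have h2 := measureReal_union_le (μ := μ) (⋃ p ∈ N, low p) (⋃ p ∈ N, up p)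
    have h3 := measureReal_union_le (μ := μ) (⋃ p ∈ N, large p) (⋃ j, noise j)
    linarith
  · simp only [Set.mem_compl_iff, Set.mem_union, Set.mem_iUnion, not_or, not_exists] at hω
    obtain ⟨⟨h1, h2⟩, h3, h4⟩ := hω
    refine norm_sub_le_of_gradient_le (x := fun i => x i ω) (e := fun i => ε i ω) hn hα hT0 hT hlam
      (by positivity) (fun u hu => ?_) (fun u hu => ?_) (fun j => ?_) hw hgrad
    · exact sum_inner_sq_ge_of_net hlam hδ hδ1 hδS hN
        (fun p hp => (not_le.1 (h1 p hp)).le) (fun p hp => (not_le.1 (h2 p hp)).le) hu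
    · refine sum_contamination_le_of_net hNhalf (fun p hp => ?_) hu.le
      refine (not_le.1 (h3 p hp)).le.trans_eq ?_
      ring
    · exact (not_le.1 (h4 j)).le

end Main

end TruncatedLoss

/-! ### The theorem: choice of constants -/

theorem theorem3 :
    -- `c`, `c'` are absolute constants
    ∃ c c' : ℝ, 0 < c ∧ 0 < c' ∧
    -- `C₀`, `C` depend only on the sub-Gaussian parameter and on the smallest eigenvalue
    ∀ (σ : ℝ≥0) (lam : ℝ), 0 < σ → 0 < lam →
    ∃ C₀ C : ℝ, 0 < C₀ ∧ 0 < C ∧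
    ∀ (d n : ℕ), 0 < d → 0 < n → C₀ * (d * Real.log d) ≤ n →
    ∀ {Ω : Type*} [MeasurableSpace Ω] (μ : Measure Ω) [IsProbabilityMeasure μ]
      (x : Fin n → Ω → EuclideanSpace ℝ (Fin d)) (ε : Fin n → Ω → ℝ)
      (wstar : EuclideanSpace ℝ (Fin d)),
    TruncatedLoss.IsRegressionSample x ε μ →
    (∀ i, TruncatedLoss.IsSubGaussianVector (x i) σ μ) →
    (∀ i, TruncatedLoss.minEigenvalue (TruncatedLoss.covarianceMatrix (x i) μ) = lam) →
    ∀ (α T r tol : ℝ), 0 < α → 0 < T → T ≤ √α / 2 → 0 < r →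
    (∀ i, c * (σ : ℝ) ^ 2 *
        (√(μ.real {ω | T ^ 2 / 4 ≤ (ε i ω) ^ 2}) +
          Real.exp (-c' * T ^ 2 / (2 * (σ : ℝ) ^ 2 * r ^ 2))) ≤ lam / 20) →
    -- a high probability event on which the bound holds for all approximate stationary points
    ∃ E : Set Ω, MeasurableSet E ∧ 1 - c * Real.exp (-c' * Real.log d) ≤ μ.real E ∧
      ∀ ω ∈ E, ∀ w : EuclideanSpace ℝ (Fin d),
        ‖w - wstar‖ ≤ r →
        ‖gradient (TruncatedLoss.truncatedLoss α (fun i => x i ω)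
            (fun i => ⟪wstar, x i ω⟫_ℝ + ε i ω)) w‖ ≤ tol →
        ‖w - wstar‖ ≤
          C * (√(α * d * Real.log d / n) + d * Real.log d / n * (T ^ 2 / r) + tol) := by
  -- 2560 = 10 · 256 turns λ/20 into the bound λ/200 on the mean contamination; 1/256 matches
  -- (T/(2r))²/(128σ²) = T²/(512σ²r²).
  refine ⟨2560, 1 / 256, by norm_num, by norm_num, fun σ lam hσ hlam => ?_⟩
  have hσ' : (0 : ℝ) < σ := hσ
  set δ : ℝ := min (1 / 10) (2 / 25 * lam / (4 * (8 * (σ : ℝ) ^ 2 + lam / 20))) with hδdef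
  have hδ : 0 < δ := lt_min (by norm_num) (by positivity)
  have hδ1 : δ ≤ 1 / 10 := min_le_left _ _
  have hδS : δ ^ 2 * (4 * (8 * (σ : ℝ) ^ 2 + lam / 20)) ≤ 2 / 25 * lam := by
    rw [← le_div_iff₀ (by positivity)]
    refine le_trans ?_ (min_le_right (1 / 10) (2 / 25 * lam / (4 * (8 * (σ : ℝ) ^ 2 + lam / 20))))
    rw [← hδdef]
    nlinarith
  set K : ℝ := 1 + Real.log (3 / δ) / Real.log 2 with hK
  have hK0 : 0 < K + 1 := by
    have h1 : 0 ≤ Real.log (3 / δ) := Real.log_nonneg ((one_le_div hδ).2 (by linarith))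
    have h2 : 0 < Real.log 2 := Real.log_pos one_lt_two
    positivity
  set η : ℝ := 1 / (80 * (σ : ℝ) ^ 2) with hη
  have hη0 : 0 < η := by positivity
  set κ : ℝ := min (TruncatedLoss.chernoffRate η (lam / 20))
    (TruncatedLoss.chernoffRate η (lam / 200)) with hκ
  have hκ0 : 0 < κ := lt_min (TruncatedLoss.chernoffRate_pos hη0 (by positivity))
    (TruncatedLoss.chernoffRate_pos hη0 (by positivity))
  refine ⟨(K + 1) / κ, 10 / lam * (1 + 2 * σ), by positivity, by positivity, ?_⟩
  intro d n hd hn hnd Ω _ μ _ x ε wstar hs hx hmin α T r tol hα hT0 hT hr hcont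
  rcases hd.nat_succ_le.eq_or_lt with hd1 | hd2
  -- For d = 1 the logarithm vanishes and the required probability is negative.
  · refine ⟨∅, MeasurableSet.empty, ?_, by simp⟩
    subst hd1
    norm_num
  have hd2' : (2 : ℝ) ≤ d := by exact_mod_cast hd2
  have hlog : 0 ≤ Real.log d := Real.log_nonneg (by linarith)
  have hrate : (K + 1) * (d * Real.log d) ≤ n * κ := by
    rwa [div_mul_eq_mul_div, div_le_iff₀ hκ0] at hnd
  obtain ⟨E, hE, hprob, hbound⟩ := TruncatedLoss.exists_event_norm_sub_le (tol := tol) hσ hlam hδ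
    hδ1 hδS hd2 hn
    (hrate.trans (mul_le_mul_of_nonneg_left (min_le_left _ _) (Nat.cast_nonneg n)))
    (hrate.trans (mul_le_mul_of_nonneg_left (min_le_right _ _) (Nat.cast_nonneg n)))
    wstar hs hx hmin hα hT0 hT hr (fun i => by
      have h1 := hcont i
      have h2 : -(1 / 256) * T ^ 2 / (2 * (σ : ℝ) ^ 2 * r ^ 2)
          = -((T / (2 * r)) ^ 2 / (128 * (σ : ℝ) ^ 2)) := by
        field_simp
        norm_num
      rw [h2] at h1
      linarith)
  refine ⟨E, hE, le_trans ?_ hprob, fun ω hω w hw hgrad => ?_⟩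
  · have h1 : Real.exp (-Real.log d) ≤ Real.exp (-(1 / 256) * Real.log d) :=
      Real.exp_le_exp.2 (by linarith)
    linarith [Real.exp_pos (-(1 / 256) * Real.log d)]
  · have htol : 0 ≤ tol := (norm_nonneg _).trans hgrad
    have h1 := hbound ω hω w hw hgrad
    have h2 : √d * (2 * σ * √(α * Real.log d / n)) = 2 * σ * √(α * d * Real.log d / n) := by
      rw [show α * d * Real.log d / n = d * (α * Real.log d / n) by ring,
        Real.sqrt_mul (Nat.cast_nonneg d)]
      ring
    rw [h2] at h1
    have h3 : ‖w - wstar‖ ≤ 10 / lam * (tol + 2 * σ * √(α * d * Real.log d / n)) := by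
      rw [div_mul_eq_mul_div, le_div_iff₀ hlam]
      linarith
    refine h3.trans ?_
    rw [mul_assoc (10 / lam)]
    refine mul_le_mul_of_nonneg_left ?_ (by positivity)
    have h4 : 0 ≤ √(α * d * Real.log d / n) := Real.sqrt_nonneg _
    -- The argument does not produce this term; being nonnegative, it is simply added to the bound.
    have h5 : 0 ≤ d * Real.log d / n * (T ^ 2 / r) := by positivity
    nlinarith [mul_nonneg hσ'.le htol, mul_nonneg hσ'.le h5]
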